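/- **Setting.** There are $N$ users, $K$ arms and $D$ objectives. At every round $t\ge 1$ each user $n\in[N]$ is offered a fixed nonempty set $\mathcal A_t^n\subseteq[K]$ of arms, and the learner pulls one arm $a_t^n\in\mathcal A_t^n$ for this user. It then observes a reward vector $\boldsymbol r_t^n\in[0,1]^D$, a fresh draw from the fixed law of the pulled arm $i=a_t^n$ (mean $\boldsymbol\mu_i$), and the user's preference vector $\boldsymbol c_t^n$, drawn from the fixed law of user $n$ on nonnegative vectors with $\|\boldsymbol c_t^n\|_1\le\delta$ (mean $\overline{\boldsymbol c}^n$). All laws are unknown to the learner, and all reward and preference vectors are mutually independent. Let $a_t^{n*}\in\arg\max_{i\in\mathcal A_t^n}\overline{\boldsymbol c}^{n\top}\boldsymbol\mu_i$, let $\eta_{i,t}^n=\overline{\boldsymbol c}^{n\top}(\boldsymbol\mu_{a_t^{n*}}-\boldsymbol\mu_i)$, and let the regret be $R(T)=\sum_{t=1}^T\sum_{n=1}^N\eta^n_{a_t^n,t}$. **Algorithm (PRUCB-UP with parameter $\alpha\in(0,1]$).** For all $t\ge1$ and $n\in[N]$, $$a_t^n\in\arg\max_{i\in\mathcal A_t^n}\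 \hat{\boldsymbol c}_t^{n\top}\Big(\hat{\boldsymbol r}_{i,t}+\sqrt{\tfrac{\log(t/\alpha)}{\max\{1,N_{i,t}\}}}\,(1,\dots,1)^\top\Big).$$ Here $\hat{\boldsymbol c}_t^n$ is the empirical mean of $\boldsymbol c_1^n,\dots,\boldsymbol c_{t-1}^n$ (and $\boldsymbol 0$ for $t=1$), $N_{i,t}$ is the number of pulls of arm $i$, over all users, before round $t$, and $\hat{\boldsymbol r}_{i,t}$ is the empirical mean of the $N_{i,t}$ corresponding rewards (and $\boldsymbol 0$ if $N_{i,t}=0$). Ties are broken by any rule that uses only earlier rounds and possibly independent randomness. **Gaps.** Let $\mathcal T_i^n=\{t\in[T]: i\in\mathcal A_t^n,\ i\text{ is not optimal in }\mathcal A_t^n\}$, and for $\mathcal T_i^n\neq\emptyset$ let $\eta_i^{n\uparrow}=\max_{t\in\mathcal T_i^n}\eta_{i,t}^n$, $\eta_i^{n\downarrow}=\min_{t\in\mathcal T_i^n}\eta_{i,t}^n>0$ and $\|\Delta_i^{n\uparrow}\|_2=\max_{t\in\mathcal T_i^n,\,j\in\mathcal A_t^n}\|\boldsymbol\mu_i-\boldsymbol\mu_j\|_2$.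 **Theorem.** There is a universal constant $C>0$ such that for all such instances, all $\alpha\in(0,1]$ and all $T\ge1$, $$\mathbb E[R(T)]\le C\sum_{n\in[N]}\ \sum_{i:\ \mathcal T_i^n\ne\emptyset}\Big(\underbrace{\frac{\delta^2\log (T/\alpha)}{\eta_i^{n\downarrow}}+D\pi^2\alpha^2\eta_i^{n\uparrow}}_{R_T^r}+\underbrace{\frac{D^2\|\Delta_i^{n\uparrow}\|_2^2\,\delta^2}{\eta_i^{n\downarrow}}}_{R_T^c}\Big),$$ and $\log(T/\alpha)$ can be replaced by $\log T$ as soon as $T\ge 1/\alpha$. Moreover, the $R_T^c$-part and the $R_T^r$-part bound the expected regret caused by preference estimation errors and by reward estimation errors, respectively. Precisely, split $R(T)$ into the sum over those pairs $(t,n)$ with $\hat{\boldsymbol c}_t^{n\top}(\boldsymbol\mu_{a_t^{n*}}-\boldsymbol\mu_{a_t^n})\le\frac12\,\overline{\boldsymbol c}^{n\top}(\boldsymbol\mu_{a_t^{n*}}-\boldsymbol\mu_{a_t^n})$ (imprecise preference estimate) and the sum over all other pairs. Then the expectation of the first sum is at most $C\sum_{n}\sum_{i:\,\mathcal T_i^n\ne\emptyset}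 D^2\|\Delta_i^{n\uparrow}\|_2^2\delta^2/\eta_i^{n\downarrow}$, which has no $\log T$ factor, and the expectation of the second is at most $C\sum_n\sum_{i:\,\mathcal T_i^n\neq\emptyset}\big(\delta^2\log(T/\alpha)/\eta_i^{n\downarrow}+D\pi^2\alpha^2\eta_i^{n\uparrow}\big)$. -/

import Mathlib

open MeasureTheory ProbabilityTheory
open scoped Matrix

noncomputable section

namespace PAMO

/-- A preference-aware multi-objective bandit instance with `N` users, `K` arms, `D` objectives.
Rewards of an arm are drawn from a fixed law on `[0,1]^D`, preferences of a user from a fixed law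
on the nonnegative vectors of `ℓ¹`-norm at most `delta`; user `n` is offered the nonempty set
`armSet t n` of arms at round `t`. -/
structure Bandit (N K D : ℕ) where
  rewardLaw : Fin K → Measure (Fin D → ℝ)
  prefLaw : Fin N → Measure (Fin D → ℝ)
  delta : ℝ
  armSet : ℕ → Fin N → Finset (Fin K)
  reward_prob : ∀ i, IsProbabilityMeasure (rewardLaw i)
  pref_prob : ∀ n, IsProbabilityMeasure (prefLaw n)
  reward_mem : ∀ i, ∀ᵐ x ∂(rewardLaw i), ∀ d, x d ∈ Set.Icc (0 : ℝ) 1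
  pref_nonneg : ∀ n, ∀ᵐ x ∂(prefLaw n), ∀ d, 0 ≤ x d
  pref_norm : ∀ n, ∀ᵐ x ∂(prefLaw n), ∑ d, |x d| ≤ delta
  armSet_nonempty : ∀ t n, (armSet t n).Nonempty

variable {N K D : ℕ}

/-- The mean reward vector `μ_i` of arm `i`. -/
def Bandit.meanReward (I : Bandit N K D) (i : Fin K) : Fin D → ℝ :=
  fun d => ∫ x, x d ∂(I.rewardLaw i)

/-- The mean preference vector of user `n`. -/
def Bandit.meanPref (I : Bandit N K D) (n : Fin N) : Fin D → ℝ :=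
  fun d => ∫ x, x d ∂(I.prefLaw n)

/-- `i` is an optimal arm for user `n` at round `t`. -/
def Bandit.IsBestArm (I : Bandit N K D) (t : ℕ) (n : Fin N) (i : Fin K) : Prop :=
  i ∈ I.armSet t n ∧
    ∀ j ∈ I.armSet t n, I.meanPref n ⬝ᵥ I.meanReward j ≤ I.meanPref n ⬝ᵥ I.meanReward i

/-- The expected overall-reward gap of arm `i` for user `n` at round `t`, relative to the
optimal arm `best t n`. -/
def Bandit.gap (I : Bandit N K D) (best : ℕ → Fin N → Fin K) (t : ℕ) (n : Fin N) (i : Fin K) : ℝ :=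
  I.meanPref n ⬝ᵥ (I.meanReward (best t n) - I.meanReward i)

/-- The rounds `t ∈ {1,…,T}` at which arm `i` is offered to user `n` and is suboptimal. -/
def Bandit.subRounds (I : Bandit N K D) (best : ℕ → Fin N → Fin K) (T : ℕ) (n : Fin N)
    (i : Fin K) : Finset ℕ :=
  {t ∈ Finset.Icc 1 T | i ∈ I.armSet t n ∧ 0 < I.gap best t n i}

/-- The largest gap `η_i^{n↑}` (used only if `subRounds` is nonempty). -/
def Bandit.gapMax (I : Bandit N K D) (best : ℕ → Fin N → Fin K) (T : ℕ) (n : Fin N)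
    (i : Fin K) : ℝ :=
  sSup ((fun t => I.gap best t n i) '' (I.subRounds best T n i : Set ℕ))

/-- The smallest gap `η_i^{n↓}` (used only if `subRounds` is nonempty). -/
def Bandit.gapMin (I : Bandit N K D) (best : ℕ → Fin N → Fin K) (T : ℕ) (n : Fin N)
    (i : Fin K) : ℝ :=
  sInf ((fun t => I.gap best t n i) '' (I.subRounds best T n i : Set ℕ))

/-- The largest Euclidean distance `‖Δ_i^{n↑}‖₂` between the mean reward of `i` and that of an arm
offered together with it when `i` is suboptimal (used only if `subRounds` is nonempty). -/
def Bandit.distMax (I : Bandit N K D) (best : ℕ → Fin N → Fin K) (T : ℕ) (n : Fin N)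
    (i : Fin K) : ℝ :=
  sSup {x | ∃ t ∈ I.subRounds best T n i, ∃ j ∈ I.armSet t n,
    x = ‖WithLp.toLp 2 (I.meanReward i - I.meanReward j)‖}

/-- The part of the regret bound that is due to reward estimation, `L` being the logarithmic
factor. Pairs `(n, i)` for which `i` is never suboptimal contribute nothing. -/
def Bandit.rewardBound (I : Bandit N K D) (best : ℕ → Fin N → Fin K) (T : ℕ) (α L : ℝ) : ℝ :=
  ∑ n : Fin N, ∑ i : Fin K with (I.subRounds best T n i).Nonempty,
    (I.delta ^ 2 * L / I.gapMin best T n i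
      + (D : ℝ) * Real.pi ^ 2 * α ^ 2 * I.gapMax best T n i)

/-- The part of the regret bound that is due to preference estimation. -/
def Bandit.prefBound (I : Bandit N K D) (best : ℕ → Fin N → Fin K) (T : ℕ) : ℝ :=
  ∑ n : Fin N, ∑ i : Fin K with (I.subRounds best T n i).Nonempty,
    (D : ℝ) ^ 2 * I.distMax best T n i ^ 2 * I.delta ^ 2 / I.gapMin best T n i

variable {Ω : Type*}

/-- `r t n i` is the reward vector that user `n` generates at round `t` if arm `i` is pulled for
this user, `c t n` the preference of user `n` at round `t`: all these vectors are mutually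
independent and have the laws prescribed by the instance. -/
structure IsEnvironment [MeasurableSpace Ω] (I : Bandit N K D) (P : Measure Ω)
    (r : ℕ → Fin N → Fin K → Ω → (Fin D → ℝ)) (c : ℕ → Fin N → Ω → (Fin D → ℝ)) : Prop where
  measurable_reward : ∀ t n i, Measurable (r t n i)
  measurable_pref : ∀ t n, Measurable (c t n)
  law_reward : ∀ t n i, P.map (r t n i) = I.rewardLaw i
  law_pref : ∀ t n, P.map (c t n) = I.prefLaw n
  indep : iIndepFun
    (fun k : (ℕ × Fin N × Fin K) ⊕ (ℕ × Fin N) =>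
      Sum.elim (fun p => r p.1 p.2.1 p.2.2) (fun p => c p.1 p.2) k) P

/-- The σ-algebra generated by all rewards and preferences of the rounds in `S`. -/
@[reducible]
def envInfo (r : ℕ → Fin N → Fin K → Ω → (Fin D → ℝ)) (c : ℕ → Fin N → Ω → (Fin D → ℝ))
    (S : Set ℕ) : MeasurableSpace Ω :=
  ⨆ s ∈ S, ⨆ n : Fin N,
    (MeasurableSpace.comap (c s n) inferInstance ⊔
      ⨆ i : Fin K, MeasurableSpace.comap (r s n i) inferInstance)

/-- `N_{i,t}`: the number of pulls of arm `i`, over all users, in the rounds before `t`. -/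
def pullCount (a : ℕ → Fin N → Ω → Fin K) (t : ℕ) (i : Fin K) (ω : Ω) : ℕ :=
  ∑ s ∈ Finset.Ico 1 t, ∑ n : Fin N, if a s n ω = i then 1 else 0

/-- The empirical mean reward of arm `i` before round `t`; it is `0` before the first pull. -/
def rewardEst (r : ℕ → Fin N → Fin K → Ω → (Fin D → ℝ)) (a : ℕ → Fin N → Ω → Fin K)
    (t : ℕ) (i : Fin K) (ω : Ω) : Fin D → ℝ :=
  (pullCount a t i ω : ℝ)⁻¹ •
    ∑ s ∈ Finset.Ico 1 t, ∑ n : Fin N, if a s n ω = i then r s n (a s n ω) ω else 0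

/-- The empirical mean preference of user `n` before round `t`; it is `0` at `t = 1`. -/
def prefEst (c : ℕ → Fin N → Ω → (Fin D → ℝ)) (t : ℕ) (n : Fin N) (ω : Ω) : Fin D → ℝ :=
  ((t : ℝ) - 1)⁻¹ • ∑ s ∈ Finset.Ico 1 t, c s n ω

/-- The Hoeffding bonus `√(log (t/α) / max {1, N_{i,t}})`. -/
def bonus (α : ℝ) (a : ℕ → Fin N → Ω → Fin K) (t : ℕ) (i : Fin K) (ω : Ω) : ℝ :=
  √(Real.log ((t : ℝ) / α) / max 1 (pullCount a t i ω : ℝ))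

/-- The index maximized by the algorithm. -/
def ucbIndex (α : ℝ) (r : ℕ → Fin N → Fin K → Ω → (Fin D → ℝ)) (c : ℕ → Fin N → Ω → (Fin D → ℝ))
    (a : ℕ → Fin N → Ω → Fin K) (t : ℕ) (n : Fin N) (i : Fin K) (ω : Ω) : ℝ :=
  prefEst c t n ω ⬝ᵥ (rewardEst r a t i ω + fun _ => bonus α a t i ω)

/-- `a` is a run of PRUCB-UP with parameter `α`: at every round `t ≥ 1`, for every user, the arm is
a maximizer of the index over the offered arms. Ties are broken in any way that looks only at
earlier rounds and at an internal source of randomness `𝒰` independent of the environment. -/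
structure IsPRUCBUP (𝒰 : MeasurableSpace Ω) [mΩ : MeasurableSpace Ω] (I : Bandit N K D)
    (P : Measure Ω) (α : ℝ)
    (r : ℕ → Fin N → Fin K → Ω → (Fin D → ℝ)) (c : ℕ → Fin N → Ω → (Fin D → ℝ))
    (a : ℕ → Fin N → Ω → Fin K) : Prop where
  seed_le : 𝒰 ≤ mΩ
  seed_indep : Indep 𝒰 (envInfo r c Set.univ) P
  adapted : ∀ t n, 1 ≤ t → Measurable[𝒰 ⊔ envInfo r c (Set.Ico 1 t)] (a t n)
  mem : ∀ t n ω, 1 ≤ t → a t n ω ∈ I.armSet t n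
  isMax : ∀ t n ω, 1 ≤ t →
    ∀ j ∈ I.armSet t n, ucbIndex α r c a t n j ω ≤ ucbIndex α r c a t n (a t n ω) ω

/-- The regret over `T` rounds and all users. -/
def regret (I : Bandit N K D) (best : ℕ → Fin N → Fin K) (a : ℕ → Fin N → Ω → Fin K) (T : ℕ)
    (ω : Ω) : ℝ :=
  ∑ t ∈ Finset.Icc 1 T, ∑ n : Fin N, I.gap best t n (a t n ω)

/-- The pull for user `n` at round `t` is attributed to an imprecise preference estimate: the
estimated preference preserves at most half of the gap between the optimal and the pulled arm. -/
def PrefError (I : Bandit N K D) (best : ℕ → Fin N → Fin K) (c : ℕ → Fin N → Ω → (Fin D → ℝ))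
    (a : ℕ → Fin N → Ω → Fin K) (t : ℕ) (n : Fin N) (ω : Ω) : Prop :=
  prefEst c t n ω ⬝ᵥ (I.meanReward (best t n) - I.meanReward (a t n ω))
    ≤ I.gap best t n (a t n ω) / 2

open Classical in
/-- The regret caused by imprecise preference estimates. -/
def regretPref (I : Bandit N K D) (best : ℕ → Fin N → Fin K) (c : ℕ → Fin N → Ω → (Fin D → ℝ))
    (a : ℕ → Fin N → Ω → Fin K) (T : ℕ) (ω : Ω) : ℝ :=
  ∑ t ∈ Finset.Icc 1 T, ∑ n : Fin N,
    if PrefError I best c a t n ω then I.gap best t n (a t n ω) else 0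

open Classical in
/-- The regret caused by imprecise reward estimates (the preference estimate being precise). -/
def regretReward (I : Bandit N K D) (best : ℕ → Fin N → Fin K) (c : ℕ → Fin N → Ω → (Fin D → ℝ))
    (a : ℕ → Fin N → Ω → Fin K) (T : ℕ) (ω : Ω) : ℝ :=
  ∑ t ∈ Finset.Icc 1 T, ∑ n : Fin N,
    if PrefError I best c a t n ω then 0 else I.gap best t n (a t n ω)

end PAMO

end

/-! ### Elementary series estimates. -/

namespace PAMO

/-! For a fixed user and suboptimal arm `i`, every pull is charged either to the preference estimate
or to the reward estimates. Each charge needs concentration in a single direction only. Write `η_t`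
for the gap, `y` for its minimum over the relevant rounds, `ρ` for `‖Δ↑‖₂`, and `δ` for the norm
bound.

Preference errors. Here the estimate must lose `η_t / 2` along the deterministic vector `μ_best -
μ_i`, whose entries are at most `ρ`. By Hölder every sample is bounded by `δρ`, so the probability
is at most `exp (-(t-1) η_t² / (8 δ²ρ²))` (`measure_prefEst_le`). The sum of `η_t exp (-t η_t² / A)`
is at most `8A/y`, although `η_t` varies with `t` (`sum_mul_exp_le`), hence no logarithm appears.

Reward errors. With a precise preference estimate and `t ≥ 3`, a pull either occurs while `N_i η_t²
≤ 128 δ² log (t/α)`, or the rewards of `i` or of the best arm deviate along the normalized estimate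
(`pull_imp_of_concentrated`). Pulls of the first kind cost `O(δ² log (T/α) / y)` on every path
(`sum_indicator_gap_le`). For the second kind, the direction is random but depends on preferences
only, which are independent of the rewards, so the exponential supermartingale tolerates it
(`lintegral_exp_sum_le_one`). A plain union over sample sizes would cost a factor `tN`. The
thresholds leave a margin of order `η_t/δ`, which makes this union a geometric series, and the
failure probability is `O(δ² / (η_t² t²))` (`measure_pull_le`). Multiplied by `η_t`, this is
summable.

The dimension enters neither argument: the factor `D²` and the term `Dπ²α²η↑` are slack. -/

theorem sum_exp_neg_mul_le {x : ℝ} (hx : 0 < x) (M : ℕ) :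
    ∑ m ∈ Finset.Icc 1 M, Real.exp (-((m : ℝ) * x)) ≤ 1 / x := by
  have hp : 0 < Real.exp (-x) := Real.exp_pos _
  -- Telescoping: `1 + x ≤ exp x` gives `x exp (-(k+1)x) ≤ exp (-kx) - exp (-(k+1)x)`.
  have key : ∀ M : ℕ, x * ∑ m ∈ Finset.Icc 1 M, Real.exp (-((m : ℝ) * x))
      ≤ 1 - Real.exp (-((M : ℝ) * x)) := by
    intro M
    induction M with
    | zero => simp
    | succ k ih =>
      rw [Finset.sum_Icc_succ_top (by omega), mul_add]
      have h1 : Real.exp (-((k : ℝ) * x)) = Real.exp x * Real.exp (-(((k + 1 : ℕ) : ℝ) * x)) := by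
        rw [← Real.exp_add]; congr 1; push_cast; ring
      have h2 := Real.add_one_le_exp x
      have h3 := Real.exp_pos (-(((k + 1 : ℕ) : ℝ) * x))
      nlinarith
  rw [le_div_iff₀ hx, mul_comm]
  exact (key M).trans (by linarith [Real.exp_pos (-((M : ℝ) * x))])

theorem sum_inv_sq_le_one (T : ℕ) : ∑ t ∈ Finset.Icc 3 T, 1 / (t : ℝ) ^ 2 ≤ 1 := by
  have key : ∀ T : ℕ, 1 ≤ T → ∑ t ∈ Finset.Icc 3 T, 1 / (t : ℝ) ^ 2 ≤ 1 - 1 / (T : ℝ) := by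
    intro T hT
    induction T, hT using Nat.le_induction with
    | base => simp
    | succ k hk ih =>
      rcases lt_or_ge (k + 1) 3 with h | h
      · rw [Finset.Icc_eq_empty (by omega), Finset.sum_empty, sub_nonneg, div_le_one (by positivity)]
        push_cast; linarith [(Nat.cast_nonneg k : (0 : ℝ) ≤ k)]
      · rw [Finset.sum_Icc_succ_top h]
        have hk0 : (0 : ℝ) < k := by exact_mod_cast hk
        have : 1 / ((k + 1 : ℕ) : ℝ) ^ 2 ≤ 1 / (k : ℝ) - 1 / ((k + 1 : ℕ) : ℝ) := by
          push_cast
          rw [div_sub_div _ _ (by positivity) (by positivity), div_le_div_iff₀ (by positivity)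
            (by positivity)]
          nlinarith
        linarith
  rcases Nat.eq_zero_or_pos T with rfl | h
  · simp
  · exact (key T h).trans (by simp)

/-- If the values `x t` obey `k * x t ^ 2 ≤ B`, where `k` is the rank of `t` in `F`, their sum is
at most `2 * √(B * #F)`. -/
theorem sum_le_of_rank_mul_sq_le (x : ℕ → ℝ) {B : ℝ} (F : Finset ℕ)
    (hF : ∀ t ∈ F, (({s ∈ F | s ≤ t}.card : ℕ) : ℝ) * x t ^ 2 ≤ B) :
    ∑ t ∈ F, x t ≤ 2 * (√B * √(F.card : ℝ)) := by
  induction F using Finset.induction_on_max with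
  | empty => simp
  | insert a s ha ih =>
    have hnot : a ∉ s := fun h => lt_irrefl _ (ha a h)
    have h1 : ∑ t ∈ s, x t ≤ 2 * (√B * √(s.card : ℝ)) := by
      apply ih
      intro t ht
      have := hF t (Finset.mem_insert_of_mem ht)
      rwa [Finset.filter_insert, if_neg (not_le.2 (ha t ht))] at this
    have h2 := hF a (Finset.mem_insert_self _ _)
    -- The largest element has full rank, so its value is at most `√B / q`. This is at most `2√B (q
    -- - p)`, the increment of the claimed bound.
    rw [Finset.filter_true_of_mem, Finset.card_insert_of_notMem hnot] at h2
    · rw [Finset.sum_insert hnot, Finset.card_insert_of_notMem hnot]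
      set p := √(s.card : ℝ)
      set q := √((s.card + 1 : ℕ) : ℝ) with hq
      have hp2 : p ^ 2 = s.card := Real.sq_sqrt (by positivity)
      have hq2 : q ^ 2 = s.card + 1 := by rw [hq, Real.sq_sqrt (by positivity)]; push_cast; ring
      have hp0 : 0 ≤ p := Real.sqrt_nonneg _
      have hq0 : 0 < q := Real.sqrt_pos.2 (by positivity)
      have hpq : p ≤ q := Real.sqrt_le_sqrt (by push_cast; linarith)
      have hb : 0 ≤ √B := Real.sqrt_nonneg _
      have hxa : q * x a ≤ √B := by
        apply Real.le_sqrt_of_sq_le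
        rw [mul_pow, hq2]; push_cast at h2; exact h2
      have h3 : 1 ≤ 2 * q * (q - p) := by nlinarith
      have h4 : q * x a ≤ q * (2 * √B * (q - p)) := by nlinarith
      have h5 := le_of_mul_le_mul_left h4 hq0
      linarith
    · intro t ht
      rcases Finset.mem_insert.1 ht with rfl | ht
      · exact le_rfl
      · exact (ha t ht).le

/-- As `sum_le_of_rank_mul_sq_le`, for values bounded below by `y`. -/
theorem sum_le_of_rank_mul_sq_le_of_le (x : ℕ → ℝ) {B y : ℝ} (hB : 0 ≤ B) (hy : 0 < y)
    (F : Finset ℕ) (hxy : ∀ t ∈ F, y ≤ x t)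
    (hF : ∀ t ∈ F, (({s ∈ F | s ≤ t}.card : ℕ) : ℝ) * x t ^ 2 ≤ B) :
    ∑ t ∈ F, x t ≤ 2 * (B / y) := by
  refine (sum_le_of_rank_mul_sq_le x F hF).trans ?_
  rcases F.eq_empty_or_nonempty with rfl | hne
  · simp; positivity
  -- The rank condition at the last element bounds the cardinality: `#F y² ≤ B`.
  have hm := F.max'_mem hne
  have h1 := hF _ hm
  rw [Finset.filter_true_of_mem (fun t ht => F.le_max' t ht)] at h1
  have h2 : (F.card : ℝ) * y ^ 2 ≤ B := by
    refine le_trans ?_ h1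
    have := hxy _ hm
    gcongr
  have h3 : √(F.card : ℝ) * y ≤ √B := by
    apply Real.le_sqrt_of_sq_le
    rw [mul_pow, Real.sq_sqrt (by positivity)]; exact h2
  gcongr
  rw [le_div_iff₀ hy]
  nlinarith [Real.sqrt_nonneg B, Real.mul_self_sqrt hB]

/-- The function `2s / (1 + qs)` of `s = √k` has derivative `2 / (1 + qs)²` in `s` and never exceeds
`2/q`; its increments dominate the summands. -/
theorem sum_inv_sqrt_le {q : ℝ} (hq : 0 < q) (n : ℕ) :
    ∑ k ∈ Finset.Icc 1 n, 1 / (√(k : ℝ) * (1 + q * √(k : ℝ)) ^ 2) ≤ 2 / q := by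
  have key : ∑ k ∈ Finset.Icc 1 n, 1 / (√(k : ℝ) * (1 + q * √(k : ℝ)) ^ 2)
      ≤ 2 * (√(n : ℝ) / (1 + q * √(n : ℝ))) := by
    induction n with
    | zero => simp
    | succ k ih =>
      rw [Finset.sum_Icc_succ_top (by omega)]
      set a := √(k : ℝ)
      set b := √((k + 1 : ℕ) : ℝ) with hb
      have ha2 : a ^ 2 = k := Real.sq_sqrt (by positivity)
      have hb2 : b ^ 2 = k + 1 := by rw [hb, Real.sq_sqrt (by positivity)]; push_cast; ring
      have ha0 : 0 ≤ a := Real.sqrt_nonneg _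
      have hb0 : 0 < b := Real.sqrt_pos.2 (by positivity)
      have hab : a ≤ b := Real.sqrt_le_sqrt (by push_cast; linarith)
      have h1 : 1 / (b * (1 + q * b) ^ 2) ≤ 2 * (b - a) / (1 + q * b) ^ 2 := by
        rw [div_le_div_iff₀ (by positivity) (by positivity)]
        have : 1 ≤ 2 * (b - a) * b := by nlinarith
        nlinarith [sq_nonneg (1 + q * b)]
      have h2 : 2 * (b / (1 + q * b)) - 2 * (a / (1 + q * a))
          = 2 * (b - a) / ((1 + q * b) * (1 + q * a)) := by
        field_simp; ring
      have h3 : 2 * (b - a) / (1 + q * b) ^ 2 ≤ 2 * (b - a) / ((1 + q * b) * (1 + q * a)) := by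
        apply div_le_div_of_nonneg_left (by linarith) (by positivity)
        rw [sq]; gcongr
      linarith
  refine key.trans ?_
  rw [mul_div_assoc', div_le_div_iff₀ (by positivity) hq]
  nlinarith [Real.sqrt_nonneg (n : ℝ)]

/-- `z * exp (-z ^ 2)` decays at least quadratically. -/
theorem mul_exp_neg_sq_le {z : ℝ} (hz : 0 ≤ z) : z * Real.exp (-z ^ 2) ≤ 4 / (1 + z) ^ 2 := by
  rw [Real.exp_neg, ← div_eq_mul_inv, div_le_div_iff₀ (Real.exp_pos _) (by positivity)]
  have h2 : 1 + z ^ 2 + (z ^ 2) ^ 2 / 2 ≤ Real.exp (z ^ 2) := by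
    have := Real.quadratic_le_exp_of_nonneg (sq_nonneg z); linarith
  nlinarith [sq_nonneg (z - 1), sq_nonneg (z ^ 2 - z), sq_nonneg (z^2-1)]

/-- The sum `∑ x_k exp (-k x_k ^ 2 / A)` is at most `8 A / y` if all `x_k` are at least `y`. -/
theorem sum_mul_exp_le {A y : ℝ} (hA : 0 < A) (hy : 0 < y) (n : ℕ) (S : Finset ℕ)
    (hS : S ⊆ Finset.Icc 1 n) (x : ℕ → ℝ) (hx : ∀ k ∈ S, y ≤ x k) :
    ∑ k ∈ S, x k * Real.exp (-((k : ℝ) * x k ^ 2 / A)) ≤ 8 * (A / y) := by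
  have hsA : 0 < √A := Real.sqrt_pos.2 hA
  have hsA2 : √A ^ 2 = A := Real.sq_sqrt hA.le
  have hterm : ∀ k ∈ S, x k * Real.exp (-((k : ℝ) * x k ^ 2 / A))
      ≤ 4 * √A * (1 / (√(k : ℝ) * (1 + y / √A * √(k : ℝ)) ^ 2)) := by
    intro k hk
    have hk1 : 1 ≤ k := (Finset.mem_Icc.1 (hS hk)).1
    have hk0 : (0 : ℝ) < k := by exact_mod_cast hk1
    have hs : 0 < √(k : ℝ) := Real.sqrt_pos.2 hk0
    have hs2 : √(k : ℝ) ^ 2 = k := Real.sq_sqrt hk0.le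
    have hxk := hx k hk
    have hx0 : 0 < x k := hy.trans_le hxk
    have h1 := mul_exp_neg_sq_le (z := x k / √A * √(k : ℝ)) (by positivity)
    have h2 : (x k / √A * √(k : ℝ)) ^ 2 = (k : ℝ) * x k ^ 2 / A := by
      rw [mul_pow, div_pow, hs2, hsA2]; ring
    rw [h2] at h1
    -- The function `z exp (-z²)` is not monotone, but its majorant `4 / (1+z)²` is decreasing; only
    -- after passing to it may `x k` be replaced by the lower bound `y`.
    have h3 : 4 / (1 + x k / √A * √(k : ℝ)) ^ 2 ≤ 4 / (1 + y / √A * √(k : ℝ)) ^ 2 := by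
      gcongr
    have h4 := h1.trans h3
    have h5 : x k * Real.exp (-((k : ℝ) * x k ^ 2 / A))
        = √A / √(k : ℝ) * (x k / √A * √(k : ℝ) * Real.exp (-((k : ℝ) * x k ^ 2 / A))) := by
      field_simp
    rw [h5]
    calc _ ≤ √A / √(k : ℝ) * (4 / (1 + y / √A * √(k : ℝ)) ^ 2) := by gcongr
      _ = _ := by field_simp
  calc _ ≤ ∑ k ∈ S, 4 * √A * (1 / (√(k : ℝ) * (1 + y / √A * √(k : ℝ)) ^ 2)) :=
        Finset.sum_le_sum hterm
    _ ≤ ∑ k ∈ Finset.Icc 1 n, 4 * √A * (1 / (√(k : ℝ) * (1 + y / √A * √(k : ℝ)) ^ 2)) :=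
        Finset.sum_le_sum_of_subset_of_nonneg hS (fun _ _ _ => by positivity)
    _ = 4 * √A * ∑ k ∈ Finset.Icc 1 n, 1 / (√(k : ℝ) * (1 + y / √A * √(k : ℝ)) ^ 2) := by
        rw [Finset.mul_sum]
    _ ≤ 4 * √A * (2 / (y / √A)) := by
        gcongr; exact sum_inv_sqrt_le (by positivity) n
    _ = 8 * (√A ^ 2 / y) := by field_simp; ring
    _ = _ := by rw [hsA2]

end PAMO

/-! ### Independence tools and Hoeffding's lemma. -/

namespace PAMO

variable {N K D : ℕ} {Ω : Type*}

/-- Probabilities factor on the π-system of intersections of an `m₀`-set with an `m₂`-set, which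
generates `m₀ ⊔ m₂`. This adjoins the tie-breaking randomness `m₀` to the information of which a
sample is independent. -/
theorem indep_sup_of_indep_sup {m₀ m₁ m₂ : MeasurableSpace Ω} [mΩ : MeasurableSpace Ω]
    {P : Measure Ω} [IsProbabilityMeasure P] (h₀ : m₀ ≤ mΩ) (h₁ : m₁ ≤ mΩ) (h₂ : m₂ ≤ mΩ)
    (h : Indep m₀ (m₁ ⊔ m₂) P) (h' : Indep m₁ m₂ P) : Indep m₁ (m₀ ⊔ m₂) P := by
  let S : Set (Set Ω) := Set.image2 (· ∩ ·) {s | MeasurableSet[m₀] s} {s | MeasurableSet[m₂] s}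
  have hS : IsPiSystem S := by
    rintro _ ⟨a, ha, b, hb, rfl⟩ _ ⟨a', ha', b', hb', rfl⟩ -
    refine ⟨a ∩ a', MeasurableSet.inter ha ha', b ∩ b', MeasurableSet.inter hb hb', ?_⟩
    exact Set.inter_inter_inter_comm _ _ _ _
  have hgen : m₀ ⊔ m₂ = MeasurableSpace.generateFrom S := by
    apply le_antisymm
    · refine sup_le (fun s hs => ?_) (fun s hs => ?_)
      · exact MeasurableSpace.measurableSet_generateFrom
          ⟨s, hs, Set.univ, MeasurableSet.univ, Set.inter_univ s⟩
      · exact MeasurableSpace.measurableSet_generateFrom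
          ⟨Set.univ, MeasurableSet.univ, s, hs, Set.univ_inter s⟩
    · apply MeasurableSpace.generateFrom_le
      rintro _ ⟨a, ha, b, hb, rfl⟩
      exact MeasurableSet.inter ((le_sup_left : m₀ ≤ m₀ ⊔ m₂) a ha)
        ((le_sup_right : m₂ ≤ m₀ ⊔ m₂) b hb)
  refine IndepSets.indep h₁ (sup_le h₀ h₂) (p1 := {s | MeasurableSet[m₁] s}) (p2 := S)
    (@MeasurableSpace.isPiSystem_measurableSet Ω m₁) hS
    (@MeasurableSpace.generateFrom_measurableSet Ω m₁).symm hgen ?_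
  rw [IndepSets_iff]
  rintro t _ ht ⟨a, ha, b, hb, rfl⟩
  rw [Indep_iff] at h h'
  have ht' : MeasurableSet[m₁ ⊔ m₂] t := (le_sup_left : m₁ ≤ m₁ ⊔ m₂) t ht
  have hb' : MeasurableSet[m₁ ⊔ m₂] b := (le_sup_right : m₂ ≤ m₁ ⊔ m₂) b hb
  have e : t ∩ (a ∩ b) = a ∩ (t ∩ b) := by rw [Set.inter_left_comm]
  show P (t ∩ (a ∩ b)) = P t * P (a ∩ b)
  rw [e, h a (t ∩ b) ha (MeasurableSet.inter ht' hb'), h' t b ht hb, h a b ha hb']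
  ring

/-- Fubini on the product of the law of `(Y, v)` and that of `X`: the fresh sample is integrated out
first, with the past frozen. Values in `ENNReal` avoid integrability conditions. -/
theorem lintegral_mul_le_of_indep {V E : Type*} [MeasurableSpace V] [MeasurableSpace E]
    {H : MeasurableSpace Ω} [mΩ : MeasurableSpace Ω] {P : Measure Ω} [IsProbabilityMeasure P]
    (hH : H ≤ mΩ) {X : Ω → E} (hX : Measurable X)
    (hind : Indep (MeasurableSpace.comap X inferInstance) H P) {Y : Ω → ENNReal}
    (hY : Measurable[H] Y) {v : Ω → V} (hv : Measurable[H] v) {g : V → E → ENNReal}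
    (hg : Measurable (Function.uncurry g)) (hg1 : ∀ w, ∫⁻ x, g w x ∂(P.map X) ≤ 1) :
    ∫⁻ ω, Y ω * g (v ω) (X ω) ∂P ≤ ∫⁻ ω, Y ω ∂P := by
  have hYv : Measurable[H] (fun ω => (Y ω, v ω)) := hY.prodMk hv
  have hYv' : Measurable (fun ω => (Y ω, v ω)) := hYv.mono hH le_rfl
  have hi : IndepFun (fun ω => (Y ω, v ω)) X P := by
    rw [IndepFun_iff_Indep]
    exact indep_of_indep_of_le_left hind.symm hYv.comap_le
  have hmap := (indepFun_iff_map_prod_eq_prod_map_map hYv'.aemeasurable hX.aemeasurable).1 hi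
  have : IsProbabilityMeasure (P.map X) := Measure.isProbabilityMeasure_map hX.aemeasurable
  have : IsProbabilityMeasure (P.map (fun ω => (Y ω, v ω))) :=
    Measure.isProbabilityMeasure_map hYv'.aemeasurable
  have hF : Measurable (fun q : (ENNReal × V) × E => q.1.1 * g q.1.2 q.2) :=
    (measurable_fst.comp measurable_fst).mul
      (hg.comp ((measurable_snd.comp measurable_fst).prodMk measurable_snd))
  calc ∫⁻ ω, Y ω * g (v ω) (X ω) ∂P
      = ∫⁻ q, q.1.1 * g q.1.2 q.2 ∂(P.map (fun ω => ((Y ω, v ω), X ω))) := by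
        rw [lintegral_map hF (hYv'.prodMk hX)]
    _ = ∫⁻ p, ∫⁻ x, p.1 * g p.2 x ∂(P.map X) ∂(P.map (fun ω => (Y ω, v ω))) := by
        rw [hmap, lintegral_prod _ hF.aemeasurable]
    _ ≤ ∫⁻ p, p.1 ∂(P.map (fun ω => (Y ω, v ω))) := by
        apply lintegral_mono
        intro p
        have hgp : Measurable (g p.2) := hg.comp (measurable_const.prodMk measurable_id)
        show ∫⁻ x, p.1 * g p.2 x ∂(P.map X) ≤ p.1
        rw [lintegral_const_mul _ hgp]
        exact mul_le_of_le_one_right' (hg1 p.2)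
    _ = ∫⁻ ω, Y ω ∂P := lintegral_map measurable_fst hYv'

theorem abs_dotProduct_le (v x : Fin D → ℝ) {B : ℝ} (hx : ∀ d, |x d| ≤ B) :
    |v ⬝ᵥ x| ≤ (∑ d, |v d|) * B := by
  rw [dotProduct, Finset.sum_mul]
  refine (Finset.abs_sum_le_sum_abs _ _).trans (Finset.sum_le_sum fun d _ => ?_)
  rw [abs_mul]
  exact mul_le_mul_of_nonneg_left (hx d) (abs_nonneg _)

theorem integrable_coord {ρ : Measure (Fin D → ℝ)} [IsProbabilityMeasure ρ] {B : ℝ}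
    (h : ∀ᵐ x ∂ρ, ∀ d, |x d| ≤ B) (d : Fin D) : Integrable (fun x => x d) ρ :=
  Integrable.of_bound (measurable_pi_apply d).aestronglyMeasurable B
    (h.mono fun x hx => by simpa using hx d)

theorem integral_dotProduct {ρ : Measure (Fin D → ℝ)} (h : ∀ d, Integrable (fun x => x d) ρ)
    (v : Fin D → ℝ) : ∫ x, v ⬝ᵥ x ∂ρ = v ⬝ᵥ fun d => ∫ x, x d ∂ρ := by
  simp only [dotProduct]
  rw [integral_finsetSum _ fun d _ => (h d).const_mul _]
  simp only [integral_const_mul]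

/-- Hoeffding's lemma for a linear functional of a random vector of the unit cube. -/
theorem lintegral_exp_dotProduct_le_one {ρ : Measure (Fin D → ℝ)} [IsProbabilityMeasure ρ]
    (h : ∀ᵐ x ∂ρ, ∀ d, x d ∈ Set.Icc (0 : ℝ) 1) (v : Fin D → ℝ) :
    ∫⁻ x, ENNReal.ofReal (Real.exp (v ⬝ᵥ (x - fun d => ∫ x, x d ∂ρ) - (∑ d, |v d|) ^ 2 / 8)) ∂ρ
      ≤ 1 := by
  have hint : ∀ d, Integrable (fun x => x d) ρ := integrable_coord (B := 1)
    (h.mono fun x hx d => abs_le.2 ⟨by linarith [(hx d).1], (hx d).2⟩)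
  -- The range of the functional on the unit cube is an interval whose length is the ℓ¹-norm of `v`;
  -- hence the variance proxy `‖v‖₁² / 4`.
  have hmem : ∀ᵐ x ∂ρ, v ⬝ᵥ x ∈ Set.Icc (∑ d, min (v d) 0) (∑ d, max (v d) 0) := by
    filter_upwards [h] with x hx
    constructor
    · refine Finset.sum_le_sum fun d _ => ?_
      obtain ⟨h0, h1⟩ := hx d
      rcases le_total (v d) 0 with hv | hv
      · rw [min_eq_left hv]; nlinarith
      · rw [min_eq_right hv]; positivity
    · refine Finset.sum_le_sum fun d _ => ?_
      obtain ⟨h0, h1⟩ := hx d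
      rcases le_total (v d) 0 with hv | hv
      · rw [max_eq_right hv]; nlinarith
      · rw [max_eq_left hv]; nlinarith
  have hmeas : Measurable (fun x : Fin D → ℝ => v ⬝ᵥ x) := by
    unfold dotProduct; fun_prop
  have hs := hasSubgaussianMGF_of_mem_Icc hmeas.aemeasurable hmem
  have hlen : (∑ d, max (v d) 0) - ∑ d, min (v d) 0 = ∑ d, |v d| := by
    rw [← Finset.sum_sub_distrib]
    refine Finset.sum_congr rfl fun d _ => ?_
    rw [max_sub_min_eq_abs, zero_sub, abs_neg]
  have hle := hs.mgf_le 1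
  have hinte := hs.integrable_exp_mul 1
  rw [hlen] at hle
  simp only [mgf, one_mul, integral_dotProduct hint] at hle hinte
  have heq : ∀ x : Fin D → ℝ,
      Real.exp (v ⬝ᵥ (x - fun d => ∫ x, x d ∂ρ) - (∑ d, |v d|) ^ 2 / 8)
        = Real.exp (v ⬝ᵥ x - v ⬝ᵥ fun d => ∫ x, x d ∂ρ) * Real.exp (-((∑ d, |v d|) ^ 2 / 8)) := by
    intro x
    rw [← Real.exp_add, dotProduct_sub]; rfl
  simp only [heq]
  rw [← ofReal_integral_eq_lintegral_ofReal (hinte.mul_const _)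
    (Filter.Eventually.of_forall fun x => by positivity), integral_mul_const,
    ENNReal.ofReal_le_one]
  calc _ ≤ Real.exp ((∑ d, |v d|) ^ 2 / 8) * Real.exp (-((∑ d, |v d|) ^ 2 / 8)) := by
        gcongr
        refine hle.trans (Real.exp_le_exp.2 (le_of_eq ?_))
        have : 0 ≤ ∑ d, |v d| := Finset.sum_nonneg fun _ _ => abs_nonneg _
        push_cast
        rw [Real.norm_of_nonneg this]; ring
    _ = 1 := by rw [← Real.exp_add, add_neg_cancel, Real.exp_zero]

end PAMO

/-! ### Information structure and concentration of adaptively sampled rewards. -/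

namespace PAMO

variable {N K D : ℕ} {Ω : Type*}

/-- All reward and preference vectors as one family. -/
def envFamily (r : ℕ → Fin N → Fin K → Ω → (Fin D → ℝ)) (c : ℕ → Fin N → Ω → (Fin D → ℝ))
    (k : (ℕ × Fin N × Fin K) ⊕ (ℕ × Fin N)) : Ω → (Fin D → ℝ) :=
  Sum.elim (fun p => r p.1 p.2.1 p.2.2) (fun p => c p.1 p.2) k

/-- The σ-algebra of the internal randomness and of all environment vectors but the one at `k`. -/
@[reducible]
def otherInfo (𝒰 : MeasurableSpace Ω) (r : ℕ → Fin N → Fin K → Ω → (Fin D → ℝ))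
    (c : ℕ → Fin N → Ω → (Fin D → ℝ)) (k : (ℕ × Fin N × Fin K) ⊕ (ℕ × Fin N)) :
    MeasurableSpace Ω :=
  𝒰 ⊔ ⨆ j ∈ ({k}ᶜ : Set ((ℕ × Fin N × Fin K) ⊕ (ℕ × Fin N))),
    MeasurableSpace.comap (envFamily r c j) inferInstance

/-- The σ-algebra of all preference vectors. -/
@[reducible]
def prefInfo (c : ℕ → Fin N → Ω → (Fin D → ℝ)) : MeasurableSpace Ω :=
  ⨆ t, ⨆ n, MeasurableSpace.comap (c t n) inferInstance

theorem pullCount_eq_sum (a : ℕ → Fin N → Ω → Fin K) (t : ℕ) (i : Fin K) (ω : Ω) :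
    pullCount a t i ω
      = ∑ p ∈ Finset.Ico 1 t ×ˢ (Finset.univ : Finset (Fin N)), if a p.1 p.2 ω = i then 1 else 0 := by
  rw [Finset.sum_product]; rfl

section Info

variable {𝒰 : MeasurableSpace Ω} {r : ℕ → Fin N → Fin K → Ω → (Fin D → ℝ)}
  {c : ℕ → Fin N → Ω → (Fin D → ℝ)}

theorem comap_le_otherInfo {j k : (ℕ × Fin N × Fin K) ⊕ (ℕ × Fin N)} (h : j ≠ k) :
    MeasurableSpace.comap (envFamily r c j) inferInstance ≤ otherInfo 𝒰 r c k :=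
  le_sup_of_le_right (le_iSup₂_of_le j h le_rfl)

theorem prefInfo_le_otherInfo (p : ℕ × Fin N × Fin K) :
    prefInfo c ≤ otherInfo 𝒰 r c (Sum.inl p) :=
  iSup₂_le fun t n => comap_le_otherInfo (r := r) (c := c) (j := Sum.inr (t, n)) (by simp)

/-- The history stops strictly before round `s`, so it does not contain the reward vector removed at
round `t`. Therefore all arm choices up to and including round `t` are independent of that vector.
-/
theorem history_le_otherInfo {s t : ℕ} (hst : s ≤ t) (n : Fin N) (i : Fin K) :
    𝒰 ⊔ envInfo r c (Set.Ico 1 s) ≤ otherInfo 𝒰 r c (Sum.inl (t, n, i)) := by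
  refine sup_le le_sup_left (iSup₂_le fun s' hs' => iSup_le fun n' => sup_le ?_ ?_)
  · exact comap_le_otherInfo (r := r) (c := c) (j := Sum.inr (s', n')) (by simp)
  · refine iSup_le fun i' => ?_
    refine comap_le_otherInfo (r := r) (c := c) (j := Sum.inl (s', n', i')) fun h => ?_
    have h1 := congrArg Prod.fst (Sum.inl.inj h)
    exact absurd (h1 : s' = t) (by have := hs'.2; omega)

theorem comap_envFamily_le_envInfo (k : (ℕ × Fin N × Fin K) ⊕ (ℕ × Fin N)) :
    MeasurableSpace.comap (envFamily r c k) inferInstance ≤ envInfo r c Set.univ := by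
  rcases k with ⟨t, n, i⟩ | ⟨t, n⟩
  · refine le_iSup₂_of_le t (Set.mem_univ t) (le_iSup_of_le n (le_sup_of_le_right ?_))
    exact le_iSup_of_le i le_rfl
  · exact le_iSup₂_of_le t (Set.mem_univ t) (le_iSup_of_le n (le_sup_of_le_left le_rfl))

end Info

theorem measurable_exp_sum [mΩ : MeasurableSpace Ω] {r : ℕ → Fin N → Fin K → Ω → (Fin D → ℝ)}
    {a : ℕ → Fin N → Ω → Fin K} {u : Ω → Fin D → ℝ} (hu : Measurable u) (μ : Fin D → ℝ)
    {i : Fin K} (A : Finset (ℕ × Fin N)) (ha : ∀ q ∈ A, MeasurableSet {ω | a q.1 q.2 ω = i})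
    (hr : ∀ q ∈ A, Measurable (r q.1 q.2 i)) :
    Measurable (fun ω => ENNReal.ofReal (Real.exp (∑ p ∈ A, if a p.1 p.2 ω = i then
      u ω ⬝ᵥ (r p.1 p.2 i ω - μ) - (∑ d, |u ω d|) ^ 2 / 8 else 0))) := by
  refine (Real.measurable_exp.comp (Finset.measurable_fun_sum A fun q hq => ?_)).ennreal_ofReal
  refine Measurable.ite (ha q hq) ?_ measurable_const
  have h2 := hr q hq
  simp only [dotProduct, Pi.sub_apply, ← Real.norm_eq_abs]
  fun_prop

section Run

variable {𝒰 : MeasurableSpace Ω} [mΩ : MeasurableSpace Ω] {I : Bandit N K D}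
  {P : Measure Ω} {α : ℝ}
  {r : ℕ → Fin N → Fin K → Ω → (Fin D → ℝ)} {c : ℕ → Fin N → Ω → (Fin D → ℝ)}
  {a : ℕ → Fin N → Ω → Fin K}

theorem IsEnvironment.measurable_envFamily (hE : IsEnvironment I P r c)
    (k : (ℕ × Fin N × Fin K) ⊕ (ℕ × Fin N)) : Measurable (envFamily r c k) := by
  rcases k with p | p
  · exact hE.measurable_reward p.1 p.2.1 p.2.2
  · exact hE.measurable_pref p.1 p.2

theorem IsEnvironment.prefInfo_le (hE : IsEnvironment I P r c) : prefInfo c ≤ mΩ :=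
  iSup₂_le fun t n => (hE.measurable_pref t n).comap_le

theorem IsPRUCBUP.otherInfo_le (hE : IsEnvironment I P r c) (hA : IsPRUCBUP 𝒰 I P α r c a)
    (k : (ℕ × Fin N × Fin K) ⊕ (ℕ × Fin N)) : otherInfo 𝒰 r c k ≤ mΩ :=
  sup_le hA.seed_le (iSup₂_le fun j _ => (hE.measurable_envFamily j).comap_le)

theorem IsPRUCBUP.measurable_arm (hE : IsEnvironment I P r c) (hA : IsPRUCBUP 𝒰 I P α r c a)
    {t : ℕ} (ht : 1 ≤ t) (n : Fin N) : Measurable (a t n) := by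
  refine (hA.adapted t n ht).mono (sup_le hA.seed_le ?_) le_rfl
  refine iSup₂_le fun s _ => iSup_le fun m => sup_le (hE.measurable_pref s m).comap_le ?_
  exact iSup_le fun i => (hE.measurable_reward s m i).comap_le

theorem IsPRUCBUP.measurableSet_arm (hA : IsPRUCBUP 𝒰 I P α r c a) {s t : ℕ} (hs : 1 ≤ s)
    (hst : s ≤ t) (m n : Fin N) (i j : Fin K) :
    MeasurableSet[otherInfo 𝒰 r c (Sum.inl (t, n, i))] {ω | a s m ω = j} :=
  ((hA.adapted s m hs).mono (history_le_otherInfo hst n i) le_rfl) (measurableSet_singleton j)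

theorem IsPRUCBUP.measurable_pullCount (hE : IsEnvironment I P r c) (hA : IsPRUCBUP 𝒰 I P α r c a)
    (t : ℕ) (i : Fin K) : Measurable (pullCount a t i) := by
  refine Finset.measurable_fun_sum _ fun s hs => Finset.measurable_fun_sum _ fun n _ => ?_
  exact Measurable.ite (hA.measurable_arm hE (Finset.mem_Ico.1 hs).1 n (measurableSet_singleton i))
    measurable_const measurable_const

/-- The sum of the centred rewards of arm `i` before round `t`. -/
noncomputable def centredSum (I : Bandit N K D) (r : ℕ → Fin N → Fin K → Ω → (Fin D → ℝ))
    (a : ℕ → Fin N → Ω → Fin K) (t : ℕ) (i : Fin K) (ω : Ω) : Fin D → ℝ :=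
  ∑ p ∈ Finset.Ico 1 t ×ˢ (Finset.univ : Finset (Fin N)),
    if a p.1 p.2 ω = i then r p.1 p.2 i ω - I.meanReward i else 0

theorem IsPRUCBUP.measurable_centredSum (hE : IsEnvironment I P r c)
    (hA : IsPRUCBUP 𝒰 I P α r c a) (t : ℕ) (i : Fin K) : Measurable (centredSum I r a t i) := by
  unfold centredSum
  refine Finset.measurable_fun_sum _ fun p hp => ?_
  refine Measurable.ite (hA.measurable_arm hE (Finset.mem_Ico.1 (Finset.mem_product.1 hp).1).1 p.2
    (measurableSet_singleton i)) ((hE.measurable_reward p.1 p.2 i).sub_const _) measurable_const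

variable [IsProbabilityMeasure P]

theorem IsPRUCBUP.indep_otherInfo (hE : IsEnvironment I P r c) (hA : IsPRUCBUP 𝒰 I P α r c a)
    (k : (ℕ × Fin N × Fin K) ⊕ (ℕ × Fin N)) :
    Indep (MeasurableSpace.comap (envFamily r c k) inferInstance) (otherInfo 𝒰 r c k) P := by
  have hle : ∀ j, MeasurableSpace.comap (envFamily r c j) inferInstance ≤ mΩ :=
    fun j => (hE.measurable_envFamily j).comap_le
  refine indep_sup_of_indep_sup hA.seed_le (hle k) (iSup₂_le fun j _ => hle j) ?_ ?_
  · refine indep_of_indep_of_le_right hA.seed_indep (sup_le (comap_envFamily_le_envInfo k) ?_)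
    exact iSup₂_le fun j _ => comap_envFamily_le_envInfo j
  · have hi : iIndep (fun j => MeasurableSpace.comap (envFamily r c j) inferInstance) P := by
      have h := hE.indep
      rw [iIndepFun_iff_iIndep] at h
      exact h
    have := indep_iSup_of_disjoint hle hi (S := {k}) (T := {k}ᶜ)
      (Set.disjoint_compl_right_iff_subset.2 subset_rfl)
    simpa using this

/-- The exponential supermartingale of the centred rewards of an arm, in a direction that may
depend on all preference vectors. -/
theorem lintegral_exp_sum_le_one (hE : IsEnvironment I P r c) (hA : IsPRUCBUP 𝒰 I P α r c a)
    {u : Ω → Fin D → ℝ} (hu : Measurable[prefInfo c] u) (i : Fin K) (A : Finset (ℕ × Fin N))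
    (hA1 : ∀ p ∈ A, 1 ≤ p.1) :
    ∫⁻ ω, ENNReal.ofReal (Real.exp (∑ p ∈ A, if a p.1 p.2 ω = i then
      u ω ⬝ᵥ (r p.1 p.2 i ω - I.meanReward i) - (∑ d, |u ω d|) ^ 2 / 8 else 0)) ∂P ≤ 1 := by
  -- Peeling off a pair of maximal round keeps all remaining arm choices measurable for `otherInfo`.
  -- Users of the same round may come in any order, as their rewards are different indices of the
  -- family.
  induction A using Finset.induction_on_max_value (fun p : ℕ × Fin N => p.1) with
  | empty => simp
  | insert p A hp hmax ih =>
    refine le_trans ?_ (ih fun q hq => hA1 q (Finset.mem_insert_of_mem hq))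
    have hp1 : 1 ≤ p.1 := hA1 p (Finset.mem_insert_self _ _)
    have huH : Measurable[otherInfo 𝒰 r c (Sum.inl (p.1, p.2, i))] u :=
      hu.mono (prefInfo_le_otherInfo _) le_rfl
    have hrH : ∀ q ∈ A, Measurable[otherInfo 𝒰 r c (Sum.inl (p.1, p.2, i))] (r q.1 q.2 i) := by
      intro q hq
      refine measurable_iff_comap_le.2
        (comap_le_otherInfo (r := r) (c := c) (j := Sum.inl (q.1, q.2, i)) fun h => hp ?_)
      have h1 := Sum.inl.inj h
      simp only [Prod.mk.injEq] at h1
      have : q = p := Prod.ext h1.1 h1.2.1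
      exact this ▸ hq
    have hY := measurable_exp_sum (mΩ := otherInfo 𝒰 r c (Sum.inl (p.1, p.2, i))) huH
      (I.meanReward i) A
      (fun q hq => hA.measurableSet_arm (hA1 q (Finset.mem_insert_of_mem hq)) (hmax q hq) q.2 p.2 i i)
      hrH
    -- Direction zero encodes that another arm is pulled; the corresponding factor is then `exp 0`.
    have hv : Measurable[otherInfo 𝒰 r c (Sum.inl (p.1, p.2, i))]
        (fun ω => if a p.1 p.2 ω = i then u ω else 0) :=
      Measurable.ite (hA.measurableSet_arm hp1 le_rfl p.2 p.2 i i) huH measurable_const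
    let g : (Fin D → ℝ) → (Fin D → ℝ) → ENNReal := fun w x =>
      ENNReal.ofReal (Real.exp (w ⬝ᵥ (x - I.meanReward i) - (∑ d, |w d|) ^ 2 / 8))
    have hg : Measurable (Function.uncurry g) := by
      simp only [Function.uncurry_def, g, dotProduct, Pi.sub_apply, ← Real.norm_eq_abs]
      fun_prop
    have hg1 : ∀ w, ∫⁻ x, g w x ∂(P.map (r p.1 p.2 i)) ≤ 1 := by
      intro w
      rw [hE.law_reward]
      have := I.reward_prob i
      exact lintegral_exp_dotProduct_le_one (I.reward_mem i) w
    refine le_trans (le_of_eq ?_)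
      (lintegral_mul_le_of_indep (hA.otherInfo_le hE _) (hE.measurable_reward p.1 p.2 i)
        (hA.indep_otherInfo hE (Sum.inl (p.1, p.2, i))) hY hv hg hg1)
    refine lintegral_congr fun ω => ?_
    rw [Finset.sum_insert hp, add_comm, Real.exp_add,
      ENNReal.ofReal_mul (Real.exp_nonneg _)]
    congr 1
    by_cases h : a p.1 p.2 ω = i
    · simp [h, g]
    · simp [h, g]

/-- Hoeffding's inequality for the adaptively sampled rewards of an arm, on the event that the arm
has been pulled exactly `m` times. -/
theorem measure_centredSum_ge_le (hE : IsEnvironment I P r c) (hA : IsPRUCBUP 𝒰 I P α r c a)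
    {u : Ω → Fin D → ℝ} (hu : Measurable[prefInfo c] u) (hu1 : ∀ ω, ∑ d, |u ω d| ≤ 1)
    (t : ℕ) (i : Fin K) (m : ℕ) {y : ℝ} (hy : 0 ≤ y) :
    P.real {ω | pullCount a t i ω = m ∧ (m : ℝ) * y ≤ u ω ⬝ᵥ centredSum I r a t i ω}
      ≤ Real.exp (-(2 * m * y ^ 2)) := by
  -- The scale `4y` maximizes `λmy - λ²m/8` over `λ`, with maximum `2my²`.
  have hu' : Measurable[prefInfo c] fun ω => (4 * y) • u ω := hu.const_smul (4 * y)
  have h1 := lintegral_exp_sum_le_one hE hA hu' i (Finset.Ico 1 t ×ˢ Finset.univ)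
    (fun p hp => (Finset.mem_Ico.1 (Finset.mem_product.1 hp).1).1)
  have hform : ∀ ω, (∑ p ∈ Finset.Ico 1 t ×ˢ (Finset.univ : Finset (Fin N)),
      if a p.1 p.2 ω = i then ((4 * y) • u ω) ⬝ᵥ (r p.1 p.2 i ω - I.meanReward i)
        - (∑ d, |((4 * y) • u ω) d|) ^ 2 / 8 else 0)
      = 4 * y * (u ω ⬝ᵥ centredSum I r a t i ω)
        - (4 * y * ∑ d, |u ω d|) ^ 2 / 8 * pullCount a t i ω := by
    intro ω
    have hn : ∑ d, |((4 * y) • u ω) d| = 4 * y * ∑ d, |u ω d| := by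
      rw [Finset.mul_sum]
      refine Finset.sum_congr rfl fun d _ => ?_
      rw [Pi.smul_apply, smul_eq_mul, abs_mul, abs_of_nonneg (by positivity : 0 ≤ 4 * y)]
    rw [hn, pullCount_eq_sum, centredSum, dotProduct_sum,
      Finset.mul_sum (Finset.Ico 1 t ×ˢ Finset.univ), Nat.cast_sum,
      Finset.mul_sum (Finset.Ico 1 t ×ˢ Finset.univ), ← Finset.sum_sub_distrib]
    refine Finset.sum_congr rfl fun p _ => ?_
    split_ifs
    · rw [smul_dotProduct, smul_eq_mul]; ring
    · simp
  simp only [hform] at h1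
  set E := {ω | pullCount a t i ω = m ∧ (m : ℝ) * y ≤ u ω ⬝ᵥ centredSum I r a t i ω}
  have hum : ∀ d, Measurable fun ω => u ω d := fun d =>
    (measurable_pi_apply d).comp (hu.mono hE.prefInfo_le le_rfl)
  have hSm : ∀ d, Measurable fun ω => centredSum I r a t i ω d := fun d =>
    (measurable_pi_apply d).comp (hA.measurable_centredSum hE t i)
  have hEm : MeasurableSet E := by
    have h1 : MeasurableSet {ω | (m : ℝ) * y ≤ u ω ⬝ᵥ centredSum I r a t i ω} := by
      refine measurableSet_le measurable_const ?_
      exact Finset.measurable_fun_sum _ fun d _ => (hum d).mul (hSm d)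
    exact (hA.measurable_pullCount hE t i (measurableSet_singleton m)).inter h1
  -- Markov's inequality; on `E` the pull count is fixed, so the compensator is at most a constant.
  have h2 : ENNReal.ofReal (Real.exp (2 * m * y ^ 2)) * P E ≤ 1 := by
    rw [← setLIntegral_const]
    refine le_trans (setLIntegral_mono' hEm fun ω hω => ?_) ((setLIntegral_le_lintegral E _).trans h1)
    refine ENNReal.ofReal_le_ofReal (Real.exp_le_exp.2 ?_)
    obtain ⟨hm, hS⟩ := hω
    rw [hm]
    have h3 : (4 * y * ∑ d, |u ω d|) ^ 2 ≤ (4 * y) ^ 2 := by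
      have := hu1 ω
      have h0 : 0 ≤ ∑ d, |u ω d| := Finset.sum_nonneg fun _ _ => abs_nonneg _
      have : 4 * y * ∑ d, |u ω d| ≤ 4 * y * 1 := by gcongr
      rw [mul_one] at this
      gcongr
    have h4 : (4 * y * ∑ d, |u ω d|) ^ 2 / 8 * m ≤ (4 * y) ^ 2 / 8 * m := by gcongr
    have h5 : 4 * y * (m * y) ≤ 4 * y * (u ω ⬝ᵥ centredSum I r a t i ω) := by gcongr
    nlinarith
  have h3 : Real.exp (2 * m * y ^ 2) * P.real E ≤ 1 := by
    have := ENNReal.toReal_mono ENNReal.one_ne_top h2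
    rwa [ENNReal.toReal_mul, ENNReal.toReal_ofReal (Real.exp_nonneg _), ENNReal.toReal_one] at this
  rw [Real.exp_neg, ← one_div, le_div_iff₀ (Real.exp_pos _), mul_comm]
  exact h3

end Run

end PAMO

/-! ### Bounds on means and gaps of an instance. -/

namespace PAMO

variable {N K D : ℕ}

section Instance

variable (I : Bandit N K D)

theorem Bandit.meanReward_mem (i : Fin K) (d : Fin D) : I.meanReward i d ∈ Set.Icc (0 : ℝ) 1 := by
  have := I.reward_prob i
  have h := I.reward_mem i
  have hint : Integrable (fun x : Fin D → ℝ => x d) (I.rewardLaw i) :=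
    integrable_coord (B := 1) (h.mono fun x hx d => abs_le.2 ⟨by linarith [(hx d).1], (hx d).2⟩) d
  refine ⟨integral_nonneg_of_ae (h.mono fun x hx => (hx d).1), ?_⟩
  have := integral_mono_ae hint (integrable_const 1) (h.mono fun x hx => (hx d).2)
  simpa [Bandit.meanReward] using this

theorem Bandit.pref_abs_le (n : Fin N) : ∀ᵐ x ∂(I.prefLaw n), ∀ d, |x d| ≤ I.delta := by
  filter_upwards [I.pref_norm n] with x hx d
  exact (Finset.single_le_sum (f := fun d => |x d|) (fun _ _ => abs_nonneg _)
    (Finset.mem_univ d)).trans hx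

theorem Bandit.meanPref_nonneg (n : Fin N) (d : Fin D) : 0 ≤ I.meanPref n d :=
  integral_nonneg_of_ae ((I.pref_nonneg n).mono fun _ hx => hx d)

theorem Bandit.sum_meanPref_le (n : Fin N) : ∑ d, I.meanPref n d ≤ I.delta := by
  have := I.pref_prob n
  have hint := integrable_coord (I.pref_abs_le n)
  simp only [Bandit.meanPref]
  rw [← integral_finsetSum _ fun d _ => hint d]
  have := integral_mono_ae (integrable_finsetSum _ fun d _ => hint d) (integrable_const I.delta)
    ((I.pref_norm n).mono fun x hx => (Finset.sum_le_sum fun d _ => le_abs_self (x d)).trans hx)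
  simpa using this

theorem Bandit.delta_nonneg (n : Fin N) : 0 ≤ I.delta :=
  (Finset.sum_nonneg fun d _ => I.meanPref_nonneg n d).trans (I.sum_meanPref_le n)

theorem Bandit.abs_meanPref_dotProduct_le (n : Fin N) (x : Fin D → ℝ) {B : ℝ} (hB : 0 ≤ B)
    (hx : ∀ d, |x d| ≤ B) : |I.meanPref n ⬝ᵥ x| ≤ I.delta * B := by
  refine (abs_dotProduct_le _ x hx).trans (mul_le_mul_of_nonneg_right ?_ hB)
  simpa only [abs_of_nonneg (I.meanPref_nonneg n _)] using I.sum_meanPref_le n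

variable {I} {best : ℕ → Fin N → Fin K}

theorem Bandit.gap_nonneg (hbest : ∀ t n, I.IsBestArm t n (best t n)) {t : ℕ} {n : Fin N}
    {i : Fin K} (hi : i ∈ I.armSet t n) : 0 ≤ I.gap best t n i := by
  rw [Bandit.gap, dotProduct_sub, sub_nonneg]
  exact (hbest t n).2 i hi

theorem Bandit.gap_le_delta (t : ℕ) (n : Fin N) (i : Fin K) : I.gap best t n i ≤ I.delta := by
  have := I.abs_meanPref_dotProduct_le n (I.meanReward (best t n) - I.meanReward i) zero_le_one
    (fun d => ?_)
  · rw [mul_one] at this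
    exact (le_abs_self _).trans this
  · have h1 := I.meanReward_mem (best t n) d
    have h2 := I.meanReward_mem i d
    rw [Pi.sub_apply, abs_le]
    constructor <;> linarith [h1.1, h1.2, h2.1, h2.2]

theorem Bandit.abs_sub_le_norm (i j : Fin K) (d : Fin D) :
    |(I.meanReward j - I.meanReward i) d| ≤ ‖WithLp.toLp 2 (I.meanReward i - I.meanReward j)‖ := by
  have := PiLp.norm_apply_le (p := 2) (WithLp.toLp 2 (I.meanReward i - I.meanReward j)) d
  rw [Real.norm_eq_abs] at this
  rw [← neg_sub, Pi.neg_apply, abs_neg]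
  exact this

variable {T : ℕ} {n : Fin N} {i : Fin K} {t : ℕ}

theorem Bandit.mem_subRounds :
    t ∈ I.subRounds best T n i ↔ (1 ≤ t ∧ t ≤ T) ∧ i ∈ I.armSet t n ∧ 0 < I.gap best t n i := by
  simp [Bandit.subRounds]

theorem Bandit.gapMin_le (ht : t ∈ I.subRounds best T n i) :
    I.gapMin best T n i ≤ I.gap best t n i :=
  csInf_le ((Finset.finite_toSet _).image _).bddBelow ⟨t, ht, rfl⟩

theorem Bandit.le_gapMax (ht : t ∈ I.subRounds best T n i) :
    I.gap best t n i ≤ I.gapMax best T n i :=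
  le_csSup ((Finset.finite_toSet _).image _).bddAbove ⟨t, ht, rfl⟩

theorem Bandit.gapMin_pos (h : (I.subRounds best T n i).Nonempty) : 0 < I.gapMin best T n i := by
  obtain ⟨t, ht, h2⟩ := (Set.Nonempty.image (fun t => I.gap best t n i)
    (Finset.coe_nonempty.2 h)).csInf_mem ((Finset.finite_toSet _).image _)
  rw [Bandit.gapMin, ← h2]
  exact (Bandit.mem_subRounds.1 ht).2.2

theorem Bandit.gapMax_pos (h : (I.subRounds best T n i).Nonempty) : 0 < I.gapMax best T n i := by
  obtain ⟨t, ht⟩ := h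
  exact (Bandit.mem_subRounds.1 ht).2.2.trans_le (Bandit.le_gapMax ht)

theorem Bandit.norm_le_distMax (ht : t ∈ I.subRounds best T n i) {j : Fin K}
    (hj : j ∈ I.armSet t n) :
    ‖WithLp.toLp 2 (I.meanReward i - I.meanReward j)‖ ≤ I.distMax best T n i := by
  refine le_csSup (Set.Finite.bddAbove (Set.Finite.subset (Set.finite_range
    fun j : Fin K => ‖WithLp.toLp 2 (I.meanReward i - I.meanReward j)‖) ?_)) ⟨t, ht, j, hj, rfl⟩
  rintro x ⟨_, _, j, _, rfl⟩
  exact ⟨j, rfl⟩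

theorem Bandit.abs_sub_le_distMax (hbest : ∀ t n, I.IsBestArm t n (best t n))
    (ht : t ∈ I.subRounds best T n i) (d : Fin D) :
    |(I.meanReward (best t n) - I.meanReward i) d| ≤ I.distMax best T n i :=
  (Bandit.abs_sub_le_norm _ _ d).trans (Bandit.norm_le_distMax ht (hbest t n).1)

theorem Bandit.distMax_nonneg (hbest : ∀ t n, I.IsBestArm t n (best t n))
    (ht : t ∈ I.subRounds best T n i) : 0 ≤ I.distMax best T n i :=
  (norm_nonneg _).trans (Bandit.norm_le_distMax ht (hbest t n).1)

/-- Hölder between ℓ¹ and ℓ∞, the sup norm being at most the Euclidean norm. -/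
theorem Bandit.gap_le_delta_mul_distMax (hbest : ∀ t n, I.IsBestArm t n (best t n))
    (ht : t ∈ I.subRounds best T n i) : I.gap best t n i ≤ I.delta * I.distMax best T n i :=
  (le_abs_self _).trans (I.abs_meanPref_dotProduct_le n _ (Bandit.distMax_nonneg hbest ht)
    (Bandit.abs_sub_le_distMax hbest ht))

/-- In dimension zero all gaps vanish. This is what permits inserting the factor `D²` into a
dimension-free estimate. -/
theorem Bandit.one_le_dim (ht : t ∈ I.subRounds best T n i) : 1 ≤ D := by
  rcases Nat.eq_zero_or_pos D with rfl | h
  · have := (Bandit.mem_subRounds.1 ht).2.2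
    simp [Bandit.gap] at this
  · exact h

theorem Bandit.delta_pos (ht : t ∈ I.subRounds best T n i) : 0 < I.delta :=
  (Bandit.mem_subRounds.1 ht).2.2.trans_le (Bandit.gap_le_delta t n i)

end Instance

/-! ### Concentration of the preference estimate. -/

section Pref

variable {Ω : Type*} [mΩ : MeasurableSpace Ω] {I : Bandit N K D}
  {P : Measure Ω} [IsProbabilityMeasure P]
  {r : ℕ → Fin N → Fin K → Ω → (Fin D → ℝ)} {c : ℕ → Fin N → Ω → (Fin D → ℝ)}

/-- Hoeffding's inequality for the empirical preference in a fixed direction. -/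
theorem measure_prefEst_le (hE : IsEnvironment I P r c) (n : Fin N) (x : Fin D → ℝ) {B : ℝ}
    (hB : 0 ≤ B) (hx : ∀ d, |x d| ≤ B) (h0 : 0 ≤ I.meanPref n ⬝ᵥ x) {t : ℕ} (ht : 2 ≤ t) :
    P.real {ω | prefEst c t n ω ⬝ᵥ x ≤ (I.meanPref n ⬝ᵥ x) / 2}
      ≤ Real.exp (-(((t : ℝ) - 1) * (I.meanPref n ⬝ᵥ x) ^ 2 / (8 * (I.delta * B) ^ 2))) := by
  have := I.pref_prob n
  have hδB : 0 ≤ I.delta * B := mul_nonneg (I.delta_nonneg n) hB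
  set η := I.meanPref n ⬝ᵥ x with hη
  have ht1 : (0 : ℝ) < (t : ℝ) - 1 := by
    have : (2 : ℝ) ≤ t := by exact_mod_cast ht
    linarith
  have hdot : Measurable fun z : Fin D → ℝ => -(z ⬝ᵥ x) := by unfold dotProduct; fun_prop
  have hsub : ∀ s, HasSubgaussianMGF (fun ω => -(c s n ω ⬝ᵥ x) + η)
      ((‖I.delta * B - -(I.delta * B)‖₊ / 2) ^ 2) P := by
    intro s
    have hmem : ∀ᵐ ω ∂P, -(c s n ω ⬝ᵥ x) ∈ Set.Icc (-(I.delta * B)) (I.delta * B) := by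
      have h1 : ∀ᵐ z ∂(P.map (c s n)), ∑ d, |z d| ≤ I.delta := by
        rw [hE.law_pref]; exact I.pref_norm n
      filter_upwards [ae_of_ae_map (hE.measurable_pref s n).aemeasurable h1] with ω hω
      have h2 := abs_le.1 ((abs_dotProduct_le (c s n ω) x hx).trans
        (mul_le_mul_of_nonneg_right hω hB))
      exact ⟨by linarith [h2.2], by linarith [h2.1]⟩
    have hm : Measurable fun ω => -(c s n ω ⬝ᵥ x) := hdot.comp (hE.measurable_pref s n)
    have h3 := hasSubgaussianMGF_of_mem_Icc hm.aemeasurable hmem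
    have h4 : ∫ ω, -(c s n ω ⬝ᵥ x) ∂P = -η := by
      rw [← integral_map (hE.measurable_pref s n).aemeasurable
        hdot.aestronglyMeasurable (f := fun z => -(z ⬝ᵥ x)), hE.law_pref, integral_neg]
      congr 1
      simp only [dotProduct_comm _ x]
      rw [integral_dotProduct (integrable_coord (I.pref_abs_le n)), hη, dotProduct_comm]
      rfl
    rw [h4] at h3
    simpa using h3
  have hind : iIndepFun (fun s ω => -(c s n ω ⬝ᵥ x) + η) P := by
    have h1 := hE.indep.precomp (g := fun s : ℕ => (Sum.inr (s, n) : (ℕ × Fin N × Fin K) ⊕ (ℕ × Fin N)))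
      (fun s s' h => by simpa using h)
    exact h1.comp (fun _ z => -(z ⬝ᵥ x) + η) fun _ => hdot.add_const η
  -- There are `t - 1` samples with variance proxy `(δB)²`, and the sum must deviate by half of its
  -- mean.
  have hH := HasSubgaussianMGF.measure_sum_ge_le_of_iIndepFun hind (s := Finset.Ico 1 t)
    (fun s _ => hsub s) (ε := ((t : ℝ) - 1) * η / 2) (by positivity)
  have hcard : ((t - 1 : ℕ) : ℝ) = (t : ℝ) - 1 := by
    rw [Nat.cast_sub (by omega)]; simp
  have hset : {ω | prefEst c t n ω ⬝ᵥ x ≤ η / 2}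
      ⊆ {ω | ((t : ℝ) - 1) * η / 2 ≤ ∑ s ∈ Finset.Ico 1 t, (-(c s n ω ⬝ᵥ x) + η)} := by
    intro ω hω
    simp only [Set.mem_ofPred_eq, prefEst, smul_dotProduct, sum_dotProduct, smul_eq_mul] at hω ⊢
    rw [Finset.sum_add_distrib, Finset.sum_neg_distrib, Finset.sum_const, Nat.card_Ico,
      nsmul_eq_mul, hcard]
    rw [inv_mul_le_iff₀ ht1] at hω
    linarith
  refine (measureReal_mono hset).trans (hH.trans (Real.exp_le_exp.2 (le_of_eq ?_)))
  rw [Finset.sum_const, Nat.card_Ico, nsmul_eq_mul, NNReal.coe_mul, NNReal.coe_natCast, hcard]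
  push_cast
  rw [Real.norm_of_nonneg (by linarith)]
  -- If `δB = 0`, both exponents are divisions by zero and equal `0`.
  rcases hδB.eq_or_lt with h | h
  · simp [← h]
  · field_simp; ring

end Pref

end PAMO

/-! ### One round: why a well-sampled suboptimal arm is rarely pulled. -/

namespace PAMO

variable {N K D : ℕ} {Ω : Type*}

/-- Needed only to make the union over sample sizes finite; the value `t * N` leaves no trace in the
final bound. -/
theorem pullCount_le (a : ℕ → Fin N → Ω → Fin K) (t : ℕ) (i : Fin K) (ω : Ω) :
    pullCount a t i ω ≤ t * N := by
  rw [pullCount_eq_sum]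
  refine (Finset.sum_le_card_nsmul _ _ 1 fun p _ => ?_).trans ?_
  · split_ifs <;> simp
  · simp only [Finset.card_product, Nat.card_Ico, Finset.card_univ, Fintype.card_fin, smul_eq_mul,
      mul_one]
    exact Nat.mul_le_mul_right N (Nat.sub_le t 1)

theorem rewardEst_eq (I : Bandit N K D) (r : ℕ → Fin N → Fin K → Ω → (Fin D → ℝ))
    (a : ℕ → Fin N → Ω → Fin K) {t : ℕ} {i : Fin K} {ω : Ω} (h : 1 ≤ pullCount a t i ω) :
    rewardEst r a t i ω
      = I.meanReward i + (pullCount a t i ω : ℝ)⁻¹ • centredSum I r a t i ω := by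
  have h0 : (pullCount a t i ω : ℝ) ≠ 0 := by
    have : pullCount a t i ω ≠ 0 := by omega
    exact_mod_cast this
  have h1 : (∑ s ∈ Finset.Ico 1 t, ∑ n : Fin N, if a s n ω = i then r s n (a s n ω) ω else 0)
      = centredSum I r a t i ω + (pullCount a t i ω : ℝ) • I.meanReward i := by
    rw [centredSum, pullCount_eq_sum, ← Finset.sum_product', Nat.cast_sum, Finset.sum_smul,
      ← Finset.sum_add_distrib]
    refine Finset.sum_congr rfl fun p _ => ?_
    by_cases hp : a p.1 p.2 ω = i <;> simp [hp]
  rw [rewardEst, h1, smul_add, smul_smul, inv_mul_cancel₀ h0, one_smul, add_comm]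

theorem rewardEst_eq_zero (r : ℕ → Fin N → Fin K → Ω → (Fin D → ℝ))
    (a : ℕ → Fin N → Ω → Fin K) {t : ℕ} {i : Fin K} {ω : Ω} (h : pullCount a t i ω = 0) :
    rewardEst r a t i ω = 0 := by
  rw [rewardEst, h]; simp

theorem dotProduct_const (w : Fin D → ℝ) (b : ℝ) : (w ⬝ᵥ fun _ => b) = (∑ d, w d) * b := by
  rw [dotProduct, Finset.sum_mul]

/-- The normalized empirical preference of a user. -/
noncomputable def unitPref (c : ℕ → Fin N → Ω → (Fin D → ℝ)) (t : ℕ) (n : Fin N) (ω : Ω) :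
    Fin D → ℝ :=
  (∑ d, |prefEst c t n ω d|)⁻¹ • prefEst c t n ω

/-- Only an inequality, since a vanishing estimate is normalized to `0`. -/
theorem sum_abs_unitPref_le (c : ℕ → Fin N → Ω → (Fin D → ℝ)) (t : ℕ) (n : Fin N) (ω : Ω) :
    ∑ d, |unitPref c t n ω d| ≤ 1 := by
  have h0 : 0 ≤ ∑ d, |prefEst c t n ω d| := Finset.sum_nonneg fun _ _ => abs_nonneg _
  simp only [unitPref, Pi.smul_apply, smul_eq_mul, abs_mul, abs_inv, abs_of_nonneg h0]
  rw [← Finset.mul_sum]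
  exact inv_mul_le_one

theorem measurable_prefEst [mΩ : MeasurableSpace Ω] {c : ℕ → Fin N → Ω → (Fin D → ℝ)} {n : Fin N}
    (h : ∀ s, Measurable (c s n)) (t : ℕ) : Measurable (prefEst c t n) := by
  unfold prefEst
  fun_prop

theorem measurable_unitPref [mΩ : MeasurableSpace Ω] {c : ℕ → Fin N → Ω → (Fin D → ℝ)} {n : Fin N}
    (h : ∀ s, Measurable (c s n)) (t : ℕ) : Measurable (unitPref c t n) := by
  have := measurable_prefEst h t
  unfold unitPref
  simp only [← Real.norm_eq_abs]
  fun_prop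

theorem measurable_unitPref_prefInfo (c : ℕ → Fin N → Ω → (Fin D → ℝ)) (t : ℕ) (n : Fin N) :
    Measurable[prefInfo c] (unitPref c t n) :=
  measurable_unitPref (mΩ := prefInfo c)
    (fun s => measurable_iff_comap_le.2 (le_iSup₂_of_le s n le_rfl)) t

/-- On the event that the sampled rewards of the arms `i` and `best t n` are well concentrated, a
suboptimal arm is not pulled once it has been sampled often enough, unless the preference estimate
is imprecise. -/
theorem pull_imp_of_concentrated {I : Bandit N K D} {best : ℕ → Fin N → Fin K} {α : ℝ}
    {r : ℕ → Fin N → Fin K → Ω → (Fin D → ℝ)} {c : ℕ → Fin N → Ω → (Fin D → ℝ)}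
    {a : ℕ → Fin N → Ω → Fin K} {t : ℕ} {n : Fin N} {i : Fin K} {ω : Ω} {L η : ℝ}
    (hL : L = Real.log ((t : ℝ) / α)) (hL1 : 1 ≤ L) (hη0 : 0 < η)
    (hδ : 0 < I.delta) (hw0 : ∀ d, 0 ≤ prefEst c t n ω d) (hwδ : ∑ d, prefEst c t n ω d ≤ I.delta)
    (hmax : ucbIndex α r c a t n (best t n) ω ≤ ucbIndex α r c a t n i ω)
    (hpe : η / 2 < prefEst c t n ω ⬝ᵥ (I.meanReward (best t n) - I.meanReward i))
    (hi : (pullCount a t i ω : ℝ) * (η / (8 * I.delta))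
      ≤ unitPref c t n ω ⬝ᵥ centredSum I r a t i ω → pullCount a t i ω = 0)
    (hj : (pullCount a t (best t n) ω : ℝ) * (√(L / pullCount a t (best t n) ω) + η / (4 * I.delta))
      ≤ (-unitPref c t n ω) ⬝ᵥ centredSum I r a t (best t n) ω →
        pullCount a t (best t n) ω = 0) :
    (pullCount a t i ω : ℝ) * η ^ 2 ≤ 128 * L * I.delta ^ 2 := by
  -- The margin `η/2` is used up as follows: `η/8` for the noise of arm `i`, `η/8` for its bonus,
  -- `η/4` for the noise of the best arm beyond its own bonus.
  by_contra! hm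
  set w := prefEst c t n ω with hw
  set W := ∑ d, w d with hW
  have hWabs : ∑ d, |w d| = W := Finset.sum_congr rfl fun d _ => abs_of_nonneg (hw0 d)
  have hdot : ∀ j, 0 ≤ w ⬝ᵥ I.meanReward j ∧ w ⬝ᵥ I.meanReward j ≤ W := by
    intro j
    refine ⟨Finset.sum_nonneg fun d _ => mul_nonneg (hw0 d) (I.meanReward_mem j d).1,
      Finset.sum_le_sum fun d _ => mul_le_of_le_one_right (hw0 d) (I.meanReward_mem j d).2⟩
  rw [dotProduct_sub] at hpe
  have hWpos : 0 < W := by linarith [(hdot (best t n)).2, (hdot i).1]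
  have hwu : w = W • unitPref c t n ω := by
    rw [unitPref, ← hw, hWabs, smul_smul, mul_inv_cancel₀ hWpos.ne', one_smul]
  have hm0 : 1 ≤ pullCount a t i ω := by
    by_contra! h
    have h0 : pullCount a t i ω = 0 := by omega
    rw [h0] at hm
    have : 0 ≤ 128 * L * I.delta ^ 2 := by positivity
    simp at hm; linarith
  have hmR : (1 : ℝ) ≤ pullCount a t i ω := by exact_mod_cast hm0
  -- An arm without pulls satisfies the deviation inequality trivially as `0 ≤ 0`; hence the
  -- hypotheses exclude deviations only for positive counts.
  have hi' : unitPref c t n ω ⬝ᵥ centredSum I r a t i ω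
      < (pullCount a t i ω : ℝ) * (η / (8 * I.delta)) := by
    by_contra! h
    have := hi h
    omega
  have hWη : W * (η / I.delta) ≤ η := by
    rw [mul_div_assoc', div_le_iff₀ hδ, mul_comm W]
    exact mul_le_mul_of_nonneg_left hwδ hη0.le
  have hindex : ∀ j, 1 ≤ pullCount a t j ω → ucbIndex α r c a t n j ω
      = w ⬝ᵥ I.meanReward j
        + W * ((pullCount a t j ω : ℝ)⁻¹ * (unitPref c t n ω ⬝ᵥ centredSum I r a t j ω))
        + W * √(L / pullCount a t j ω) := by
    intro j hj
    rw [ucbIndex, ← hw, dotProduct_add, rewardEst_eq I r a hj, dotProduct_add, dotProduct_smul,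
      dotProduct_const, bonus, max_eq_right (by exact_mod_cast hj), ← hL, ← hW]
    congr 2
    nth_rewrite 1 [hwu]
    rw [smul_dotProduct, smul_eq_mul, smul_eq_mul]; ring
  have hui : ucbIndex α r c a t n i ω < w ⬝ᵥ I.meanReward i + η / 8 + η / 8 := by
    rw [hindex i hm0]
    have h1 : (pullCount a t i ω : ℝ)⁻¹ * (unitPref c t n ω ⬝ᵥ centredSum I r a t i ω)
        < η / (8 * I.delta) := by
      rw [inv_mul_lt_iff₀ (by linarith)]; exact hi'
    have h2 : √(L / pullCount a t i ω) ≤ η / (8 * I.delta) := by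
      apply Real.sqrt_le_iff.2 ⟨by positivity, ?_⟩
      rw [div_pow, div_le_div_iff₀ (by linarith) (by positivity)]
      nlinarith [sq_nonneg I.delta, mul_nonneg (by linarith : 0 ≤ L) (sq_nonneg I.delta)]
    have h3 : W * (η / (8 * I.delta)) ≤ η / 8 := by
      have : W * (η / (8 * I.delta)) = W * (η / I.delta) / 8 := by field_simp
      linarith
    have h4 := mul_lt_mul_of_pos_left h1 hWpos
    have h5 := mul_le_mul_of_nonneg_left h2 hWpos.le
    linarith
  -- A best arm never pulled has empirical mean `0`, but its bonus `√L ≥ 1` already dominates every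
  -- mean reward in `[0,1]`.
  rcases Nat.eq_zero_or_pos (pullCount a t (best t n) ω) with h0 | hpos
  · have h1 : ucbIndex α r c a t n (best t n) ω = W * √L := by
      rw [ucbIndex, ← hw, rewardEst_eq_zero r a h0, zero_add, dotProduct_const, bonus, h0, ← hL,
        Nat.cast_zero, max_eq_left zero_le_one, div_one]
    have h2 : 1 ≤ √L := Real.one_le_sqrt.2 hL1
    have h3 : W * 1 ≤ W * √L := mul_le_mul_of_nonneg_left h2 hWpos.le
    linarith [(hdot (best t n)).2]
  · have hmj : (0 : ℝ) < pullCount a t (best t n) ω := by exact_mod_cast hpos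
    have hj' : (-unitPref c t n ω) ⬝ᵥ centredSum I r a t (best t n) ω
        < (pullCount a t (best t n) ω : ℝ)
          * (√(L / pullCount a t (best t n) ω) + η / (4 * I.delta)) := by
      by_contra! h
      have := hj h
      omega
    rw [neg_dotProduct, ← inv_mul_lt_iff₀ hmj, mul_neg] at hj'
    have h3 : W * (η / (4 * I.delta)) ≤ η / 4 := by
      have : W * (η / (4 * I.delta)) = W * (η / I.delta) / 4 := by field_simp
      linarith
    have h4 := mul_lt_mul_of_pos_left hj' hWpos
    have h5 := hindex (best t n) hpos
    linarith

section Run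

variable {𝒰 : MeasurableSpace Ω} [mΩ : MeasurableSpace Ω] {I : Bandit N K D}
  {P : Measure Ω} {α : ℝ}
  {r : ℕ → Fin N → Fin K → Ω → (Fin D → ℝ)} {c : ℕ → Fin N → Ω → (Fin D → ℝ)}
  {a : ℕ → Fin N → Ω → Fin K} {best : ℕ → Fin N → Fin K}

theorem IsEnvironment.ae_prefEst (hE : IsEnvironment I P r c) (t : ℕ) (n : Fin N) :
    ∀ᵐ ω ∂P, (∀ d, 0 ≤ prefEst c t n ω d) ∧ ∑ d, prefEst c t n ω d ≤ I.delta := by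
  have h1 : ∀ s, ∀ᵐ ω ∂P, (∀ d, 0 ≤ c s n ω d) ∧ ∑ d, |c s n ω d| ≤ I.delta := by
    intro s
    have h : ∀ᵐ z ∂(P.map (c s n)), (∀ d, 0 ≤ z d) ∧ ∑ d, |z d| ≤ I.delta := by
      rw [hE.law_pref]
      exact (I.pref_nonneg n).and (I.pref_norm n)
    exact ae_of_ae_map (hE.measurable_pref s n).aemeasurable h
  filter_upwards [ae_all_iff.2 h1] with ω hω
  rcases Nat.lt_or_ge t 2 with ht | ht
  · have : Finset.Ico 1 t = ∅ := Finset.Ico_eq_empty (by omega)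
    simp only [prefEst, this, Finset.sum_empty, smul_zero, Pi.zero_apply, le_refl, implies_true,
      Finset.sum_const_zero, true_and]
    exact I.delta_nonneg n
  · have ht1 : (0 : ℝ) < (t : ℝ) - 1 := by
      have : (2 : ℝ) ≤ t := by exact_mod_cast ht
      linarith
    have hcard : ((t - 1 : ℕ) : ℝ) = (t : ℝ) - 1 := by
      rw [Nat.cast_sub (by omega)]; simp
    constructor
    · intro d
      simp only [prefEst, Pi.smul_apply, Finset.sum_apply, smul_eq_mul]
      exact mul_nonneg (inv_nonneg.2 ht1.le) (Finset.sum_nonneg fun s _ => (hω s).1 d)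
    · simp only [prefEst, Pi.smul_apply, Finset.sum_apply, smul_eq_mul]
      rw [← Finset.mul_sum, Finset.sum_comm, inv_mul_le_iff₀ ht1]
      calc _ ≤ ∑ s ∈ Finset.Ico 1 t, I.delta := Finset.sum_le_sum fun s _ =>
            (Finset.sum_le_sum fun d _ => le_abs_self _).trans (hω s).2
        _ = _ := by rw [Finset.sum_const, Nat.card_Ico, nsmul_eq_mul, hcard]

variable [IsProbabilityMeasure P]

/-- The probability that at some sample size the rewards of arm `i` deviate by more than the
thresholds `y`, in terms of a geometric series. -/
theorem measure_exists_deviation_le (hE : IsEnvironment I P r c) (hA : IsPRUCBUP 𝒰 I P α r c a)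
    {u : Ω → Fin D → ℝ} (hu : Measurable[prefInfo c] u) (hu1 : ∀ ω, ∑ d, |u ω d| ≤ 1)
    (t : ℕ) (i : Fin K) (y : ℕ → ℝ) (hy : ∀ m, 0 ≤ y m) (p : ℕ → Prop) {L x : ℝ} (hx : 0 < x)
    (hyx : ∀ m, 1 ≤ m → p m → 2 * L + m * x ≤ 2 * m * y m ^ 2) :
    P.real {ω | ¬ ((p (pullCount a t i ω) ∧ (pullCount a t i ω : ℝ) * y (pullCount a t i ω)
      ≤ u ω ⬝ᵥ centredSum I r a t i ω) → pullCount a t i ω = 0)}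
      ≤ Real.exp (-(2 * L)) / x := by
  classical
  -- Union over the value of the pull count: each value costs `exp (-2L) exp (-m x)`, and the margin
  -- `x` makes the sum independent of the number of values.
  have hsub : {ω | ¬ ((p (pullCount a t i ω) ∧ (pullCount a t i ω : ℝ) * y (pullCount a t i ω)
      ≤ u ω ⬝ᵥ centredSum I r a t i ω) → pullCount a t i ω = 0)}
      ⊆ ⋃ m ∈ {m ∈ Finset.Icc 1 (t * N) | p m},
        {ω | pullCount a t i ω = m ∧ (m : ℝ) * y m ≤ u ω ⬝ᵥ centredSum I r a t i ω} := by
    intro ω hω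
    simp only [Set.mem_ofPred_eq, Classical.not_imp] at hω
    simp only [Set.mem_iUnion]
    refine ⟨pullCount a t i ω, ?_, rfl, hω.1.2⟩
    rw [Finset.mem_filter, Finset.mem_Icc]
    exact ⟨⟨Nat.one_le_iff_ne_zero.2 hω.2, pullCount_le a t i ω⟩, hω.1.1⟩
  calc _ ≤ _ := measureReal_mono hsub (measure_ne_top _ _)
    _ ≤ ∑ m ∈ {m ∈ Finset.Icc 1 (t * N) | p m}, P.real
        {ω | pullCount a t i ω = m ∧ (m : ℝ) * y m ≤ u ω ⬝ᵥ centredSum I r a t i ω} :=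
        measureReal_biUnion_finset_le _ _
    _ ≤ ∑ m ∈ {m ∈ Finset.Icc 1 (t * N) | p m}, Real.exp (-(2 * L)) * Real.exp (-((m : ℝ) * x)) := by
        refine Finset.sum_le_sum fun m hm => ?_
        rw [Finset.mem_filter, Finset.mem_Icc] at hm
        refine (measure_centredSum_ge_le hE hA hu hu1 t i m (hy m)).trans ?_
        rw [← Real.exp_add]
        exact Real.exp_le_exp.2 (by linarith [hyx m hm.1.1 hm.2])
    _ ≤ ∑ m ∈ Finset.Icc 1 (t * N), Real.exp (-(2 * L)) * Real.exp (-((m : ℝ) * x)) :=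
        Finset.sum_le_sum_of_subset_of_nonneg (Finset.filter_subset _ _)
          fun _ _ _ => by positivity
    _ ≤ Real.exp (-(2 * L)) * (1 / x) := by
        rw [← Finset.mul_sum]
        gcongr
        exact sum_exp_neg_mul_le hx _
    _ = _ := by ring

/-- The probability that, with a precise preference estimate, a suboptimal arm is pulled although
it has been sampled often. -/
theorem measure_pull_le (hE : IsEnvironment I P r c) (hA : IsPRUCBUP 𝒰 I P α r c a)
    (hbest : ∀ t n, I.IsBestArm t n (best t n)) (hα0 : 0 < α) (hα1 : α ≤ 1) {t : ℕ} (ht : 3 ≤ t)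
    {n : Fin N} {i : Fin K} (hgap : 0 < I.gap best t n i) :
    P.real {ω | a t n ω = i ∧ ¬ PrefError I best c a t n ω
      ∧ 128 * Real.log ((t : ℝ) / α) * I.delta ^ 2
        < (pullCount a t i ω : ℝ) * I.gap best t n i ^ 2}
      ≤ 72 * (I.delta ^ 2 / I.gap best t n i ^ 2) * (1 / (t : ℝ) ^ 2) := by
  set η := I.gap best t n i with hη
  set L := Real.log ((t : ℝ) / α) with hL
  have hδ : 0 < I.delta := hgap.trans_le (Bandit.gap_le_delta t n i)
  have ht3 : (3 : ℝ) ≤ t := by exact_mod_cast ht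
  have htα : (t : ℝ) ≤ t / α := le_div_self (by linarith) hα0 hα1
  -- This is where `t ≥ 3 > e` is needed.
  have hL1 : 1 ≤ L := by
    rw [hL, Real.le_log_iff_exp_le (by positivity)]
    linarith [Real.exp_one_lt_three]
  have hexp : Real.exp (-(2 * L)) ≤ 1 / (t : ℝ) ^ 2 := by
    have : Real.exp (-(2 * L)) = 1 / ((t : ℝ) / α) ^ 2 := by
      rw [Real.exp_neg, mul_comm, Real.exp_mul, hL, Real.exp_log (by positivity), one_div]
      norm_num
    rw [this]
    gcongr
  have hu := measurable_unitPref_prefInfo c t n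
  have hx1 : 0 < η ^ 2 / (64 * I.delta ^ 2) := by positivity
  have hx2 : 0 < η ^ 2 / (8 * I.delta ^ 2) := by positivity
  -- For arm `i` the exponent `m η² / (32 δ²)` splits into equal halves: by the lower bound on `m`,
  -- one half is at least `2L`; the other is the geometric decay.
  have h1 := measure_exists_deviation_le hE hA hu (sum_abs_unitPref_le c t n) t i
    (fun _ => η / (8 * I.delta)) (fun _ => by positivity)
    (fun m => 128 * L * I.delta ^ 2 < (m : ℝ) * η ^ 2) (L := L) hx1 (fun m _ hm => by
      have e : 2 * (m : ℝ) * (η / (8 * I.delta)) ^ 2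
        = m * (η ^ 2 / (64 * I.delta ^ 2)) + (m * η ^ 2) / (64 * I.delta ^ 2) := by
        field_simp; ring
      have : 2 * L ≤ (m * η ^ 2) / (64 * I.delta ^ 2) := by
        rw [le_div_iff₀ (by positivity)]; linarith
      linarith)
  -- For the best arm no lower bound on `m` is available. The bonus itself pays `2L`, the extra `η /
  -- (4δ)` gives the decay, and the cross term is dropped.
  have h2 := measure_exists_deviation_le hE hA hu.neg
    (fun ω => by simpa using sum_abs_unitPref_le c t n ω) t (best t n)
    (fun m => √(L / m) + η / (4 * I.delta)) (fun _ => by positivity) (fun _ => True) (L := L) hx2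
    (fun m hm _ => by
      have hm0 : (0 : ℝ) < m := by exact_mod_cast hm
      have hs : √(L / m) ^ 2 = L / m := Real.sq_sqrt (by positivity)
      have e : 2 * (m : ℝ) * (√(L / m) + η / (4 * I.delta)) ^ 2
        = 2 * m * √(L / m) ^ 2 + m * (η ^ 2 / (8 * I.delta ^ 2))
          + m * √(L / m) * (η / I.delta) := by
        field_simp; ring
      have e2 : 2 * (m : ℝ) * (L / m) = 2 * L := by field_simp
      have : 0 ≤ m * √(L / m) * (η / I.delta) := by positivity
      rw [e, hs, e2]
      linarith)
  set E₁ := {ω | ¬ ((128 * L * I.delta ^ 2 < (pullCount a t i ω : ℝ) * η ^ 2 ∧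
    (pullCount a t i ω : ℝ) * (η / (8 * I.delta)) ≤ unitPref c t n ω ⬝ᵥ centredSum I r a t i ω) →
      pullCount a t i ω = 0)}
  set E₂ := {ω | ¬ ((True ∧ (pullCount a t (best t n) ω : ℝ)
    * (√(L / (pullCount a t (best t n) ω)) + η / (4 * I.delta))
      ≤ (-unitPref c t n) ω ⬝ᵥ centredSum I r a t (best t n) ω) → pullCount a t (best t n) ω = 0)}
  -- The inclusion holds only almost surely, because the preference samples are nonnegative and
  -- bounded only almost surely.
  have hsub : {ω | a t n ω = i ∧ ¬ PrefError I best c a t n ω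
      ∧ 128 * L * I.delta ^ 2 < (pullCount a t i ω : ℝ) * η ^ 2} ≤ᵐ[P] (E₁ ∪ E₂ : Set Ω) := by
    filter_upwards [hE.ae_prefEst t n] with ω hω hmem
    obtain ⟨hai, hpe, hm⟩ := hmem
    by_contra hcon
    have hcon' : ω ∉ E₁ ∧ ω ∉ E₂ := not_or.1 hcon
    have hE₁ := not_not.1 hcon'.1
    have hE₂ := not_not.1 hcon'.2
    rw [PrefError, hai, not_le] at hpe
    have hmaxi := hA.isMax t n ω (by omega) (best t n) (hbest t n).1
    rw [hai] at hmaxi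
    exact absurd (pull_imp_of_concentrated hL hL1 hgap hδ hω.1 hω.2 hmaxi hpe
      (fun h => hE₁ ⟨hm, h⟩) (fun h => hE₂ ⟨trivial, h⟩)) (not_le.2 hm)
  calc _ ≤ P.real (E₁ ∪ E₂) := ENNReal.toReal_mono (measure_ne_top _ _) (measure_mono_ae hsub)
    _ ≤ P.real E₁ + P.real E₂ := measureReal_union_le _ _
    _ ≤ Real.exp (-(2 * L)) / (η ^ 2 / (64 * I.delta ^ 2))
        + Real.exp (-(2 * L)) / (η ^ 2 / (8 * I.delta ^ 2)) := add_le_add h1 h2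
    _ = 72 * (I.delta ^ 2 / η ^ 2) * Real.exp (-(2 * L)) := by field_simp; ring
    _ ≤ _ := by gcongr

end Run

end PAMO

/-! ### Summation over the rounds. -/

namespace PAMO

variable {N K D : ℕ} {Ω : Type*}

/-- The estimate is `0` at the first round, which is thus charged entirely to the preference part.
-/
theorem prefError_one (I : Bandit N K D) {best : ℕ → Fin N → Fin K}
    (hbest : ∀ t n, I.IsBestArm t n (best t n)) (c : ℕ → Fin N → Ω → (Fin D → ℝ))
    {a : ℕ → Fin N → Ω → Fin K} {n : Fin N} {ω : Ω} (ha : a 1 n ω ∈ I.armSet 1 n) :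
    PrefError I best c a 1 n ω := by
  have h : prefEst c 1 n ω = 0 := by simp [prefEst]
  rw [PrefError, h, zero_dotProduct]
  exact div_nonneg (Bandit.gap_nonneg hbest ha) zero_le_two

/-- The regret of a run, sorted by users and suboptimal arms. -/
theorem sum_ite_gap_eq {I : Bandit N K D} {best : ℕ → Fin N → Fin K}
    (hbest : ∀ t n, I.IsBestArm t n (best t n)) {a : ℕ → Fin N → Ω → Fin K}
    (hmem : ∀ t n ω, 1 ≤ t → a t n ω ∈ I.armSet t n) (T : ℕ) (Q : ℕ → Fin N → Ω → Prop)
    [∀ t n ω, Decidable (Q t n ω)] (ω : Ω) :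
    ∑ t ∈ Finset.Icc 1 T, ∑ n : Fin N, (if Q t n ω then I.gap best t n (a t n ω) else 0)
      = ∑ n : Fin N, ∑ i : Fin K with (I.subRounds best T n i).Nonempty,
        ∑ t ∈ I.subRounds best T n i,
          {ω | a t n ω = i ∧ Q t n ω}.indicator (fun _ => I.gap best t n i) ω := by
  classical
  rw [Finset.sum_comm]
  refine Finset.sum_congr rfl fun n _ => ?_
  rw [Finset.sum_filter_of_ne (fun i _ hi => by
    by_contra h
    rw [Finset.not_nonempty_iff_eq_empty] at h
    exact hi (by rw [h, Finset.sum_empty]))]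
  simp only [Bandit.subRounds, Finset.sum_filter]
  rw [Finset.sum_comm]
  refine Finset.sum_congr rfl fun t ht => ?_
  have ht1 := (Finset.mem_Icc.1 ht).1
  rw [Finset.sum_eq_single (a t n ω)]
  · have hm := hmem t n ω ht1
    rcases (Bandit.gap_nonneg hbest hm).eq_or_lt with h | h
    · simp [← h]
    · by_cases hQ : Q t n ω <;> simp [hQ, hm, h]
  · intro i _ hi
    have : ω ∉ {ω | a t n ω = i ∧ Q t n ω} := fun h => hi h.1.symm
    rw [Set.indicator_of_notMem this, ite_self]
  · simp

/-- Along every run, the pulls of a suboptimal arm that has not been sampled often yet cause a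
logarithmic regret only. -/
theorem sum_indicator_gap_le {I : Bandit N K D} {best : ℕ → Fin N → Fin K} {T : ℕ}
    (a : ℕ → Fin N → Ω → Fin K) {n : Fin N} {i : Fin K}
    (hne : (I.subRounds best T n i).Nonempty) {B : ℝ} (hB : 0 ≤ B) (ω : Ω) :
    ∑ t ∈ I.subRounds best T n i, {ω | a t n ω = i ∧
        (pullCount a t i ω : ℝ) * I.gap best t n i ^ 2 ≤ B}.indicator
          (fun _ => I.gap best t n i) ω
      ≤ 2 * ((B + I.delta ^ 2) / I.gapMin best T n i) := by
  classical
  set S := I.subRounds best T n i with hS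
  set F := {t ∈ S | a t n ω = i ∧ (pullCount a t i ω : ℝ) * I.gap best t n i ^ 2 ≤ B} with hF
  have hsum : ∑ t ∈ S, {ω | a t n ω = i ∧
        (pullCount a t i ω : ℝ) * I.gap best t n i ^ 2 ≤ B}.indicator
          (fun _ => I.gap best t n i) ω = ∑ t ∈ F, I.gap best t n i := by
    rw [hF, Finset.sum_filter]
    refine Finset.sum_congr rfl fun t _ => ?_
    rw [Set.indicator_apply]
    rfl
  rw [hsum]
  refine sum_le_of_rank_mul_sq_le_of_le (fun t => I.gap best t n i) (by positivity)
    (Bandit.gapMin_pos hne) F (fun t ht => Bandit.gapMin_le (Finset.mem_filter.1 ht).1) ?_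
  intro t ht
  obtain ⟨htS, _, hcount⟩ := Finset.mem_filter.1 ht
  obtain ⟨_, _, hg⟩ := Bandit.mem_subRounds.1 htS
  -- The rank of `t` counts earlier pulls by user `n`, which are among the pulls by all users, plus
  -- `t` itself. The additional one accounts for `δ²` in the bound.
  have hcard : ({s ∈ F | s ≤ t}.card) ≤ pullCount a t i ω + 1 := by
    have h1 : {s ∈ F | s ≤ t} ⊆ insert t {s ∈ Finset.Ico 1 t | a s n ω = i} := by
      intro s hs
      obtain ⟨hsF, hst⟩ := Finset.mem_filter.1 hs
      obtain ⟨hsS, hsi, _⟩ := Finset.mem_filter.1 hsF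
      rcases hst.eq_or_lt with rfl | hlt
      · exact Finset.mem_insert_self _ _
      · refine Finset.mem_insert_of_mem (Finset.mem_filter.2 ⟨?_, hsi⟩)
        exact Finset.mem_Ico.2 ⟨(Bandit.mem_subRounds.1 hsS).1.1, hlt⟩
    refine (Finset.card_le_card h1).trans ((Finset.card_insert_le _ _).trans ?_)
    refine Nat.add_le_add_right ?_ 1
    rw [Finset.card_filter]
    exact Finset.sum_le_sum fun s _ => Finset.single_le_sum
      (f := fun m : Fin N => if a s m ω = i then 1 else 0) (fun _ _ => Nat.zero_le _)
      (Finset.mem_univ n)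
  have hcard' : (({s ∈ F | s ≤ t}.card : ℕ) : ℝ) ≤ pullCount a t i ω + 1 := by exact_mod_cast hcard
  have hgδ : I.gap best t n i ^ 2 ≤ I.delta ^ 2 := by
    have := Bandit.gap_le_delta (I := I) (best := best) t n i
    gcongr
  calc _ ≤ ((pullCount a t i ω : ℝ) + 1) * I.gap best t n i ^ 2 := by gcongr
    _ ≤ _ := by linarith

section Run

variable {𝒰 : MeasurableSpace Ω} [mΩ : MeasurableSpace Ω] {I : Bandit N K D}
  {P : Measure Ω} {α : ℝ}
  {r : ℕ → Fin N → Fin K → Ω → (Fin D → ℝ)} {c : ℕ → Fin N → Ω → (Fin D → ℝ)}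
  {a : ℕ → Fin N → Ω → Fin K} {best : ℕ → Fin N → Fin K} {T : ℕ}

theorem IsPRUCBUP.measurableSet_prefError (hE : IsEnvironment I P r c)
    (hA : IsPRUCBUP 𝒰 I P α r c a) {t : ℕ} (ht : 1 ≤ t) (n : Fin N) :
    MeasurableSet {ω | PrefError I best c a t n ω} := by
  have ha := hA.measurable_arm hE ht n
  have h1 : ∀ f : Fin K → ℝ, Measurable fun ω => f (a t n ω) := fun f =>
    (measurable_of_finite f).comp ha
  have h2 : Measurable (prefEst c t n) := measurable_prefEst (fun s => hE.measurable_pref s n) t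
  refine measurableSet_le ?_ (h1 fun i => I.gap best t n i / 2)
  refine Finset.measurable_fun_sum _ fun d _ => ((measurable_pi_apply d).comp h2).mul ?_
  exact h1 fun i => (I.meanReward (best t n) - I.meanReward i) d

variable [IsProbabilityMeasure P]

theorem integrable_indicator_gap {A : Set Ω} (hA : MeasurableSet A) (x : ℝ) :
    Integrable (A.indicator fun _ => x) P :=
  (integrable_const x).indicator hA

theorem integrable_sum_ite_gap (hE : IsEnvironment I P r c) (hA : IsPRUCBUP 𝒰 I P α r c a)
    (hbest : ∀ t n, I.IsBestArm t n (best t n)) (Q : ℕ → Fin N → Ω → Prop)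
    [∀ t n ω, Decidable (Q t n ω)] (hQ : ∀ t n, 1 ≤ t → MeasurableSet {ω | Q t n ω}) :
    Integrable (fun ω => ∑ t ∈ Finset.Icc 1 T, ∑ n : Fin N,
        (if Q t n ω then I.gap best t n (a t n ω) else 0)) P ∧
      ∫ ω, ∑ t ∈ Finset.Icc 1 T, ∑ n : Fin N,
        (if Q t n ω then I.gap best t n (a t n ω) else 0) ∂P
      = ∑ n : Fin N, ∑ i : Fin K with (I.subRounds best T n i).Nonempty,
        ∑ t ∈ I.subRounds best T n i, I.gap best t n i * P.real {ω | a t n ω = i ∧ Q t n ω} := by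
  have hms : ∀ n i, ∀ t ∈ I.subRounds best T n i, MeasurableSet {ω | a t n ω = i ∧ Q t n ω} := by
    intro n i t ht
    have ht1 := (Bandit.mem_subRounds.1 ht).1.1
    exact (hA.measurable_arm hE ht1 n (measurableSet_singleton i)).inter (hQ t n ht1)
  have hint : ∀ n i, ∀ t ∈ I.subRounds best T n i,
      Integrable ({ω | a t n ω = i ∧ Q t n ω}.indicator (fun _ => I.gap best t n i)) P :=
    fun n i t ht => integrable_indicator_gap (hms n i t ht) _
  simp only [sum_ite_gap_eq hbest hA.mem T Q]
  constructor
  · exact integrable_finsetSum _ fun n _ => integrable_finsetSum _ fun i _ =>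
      integrable_finsetSum _ fun t ht => hint n i t ht
  · rw [integral_finsetSum _ fun n _ => integrable_finsetSum _ fun i _ =>
      integrable_finsetSum _ fun t ht => hint n i t ht]
    refine Finset.sum_congr rfl fun n _ => ?_
    rw [integral_finsetSum _ fun i _ => integrable_finsetSum _ fun t ht => hint n i t ht]
    refine Finset.sum_congr rfl fun i _ => ?_
    rw [integral_finsetSum _ fun t ht => hint n i t ht]
    refine Finset.sum_congr rfl fun t ht => ?_
    rw [integral_indicator_const _ (hms n i t ht), smul_eq_mul, mul_comm]

/-- Once the pulled arm is fixed to be `i`, the error event concerns a deterministic direction, so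
neither the algorithm nor the dependence between rounds matters. -/
theorem sum_gap_mul_prefError_le (hE : IsEnvironment I P r c)
    (hbest : ∀ t n, I.IsBestArm t n (best t n)) {n : Fin N} {i : Fin K}
    (hne : (I.subRounds best T n i).Nonempty) :
    ∑ t ∈ I.subRounds best T n i,
        I.gap best t n i * P.real {ω | a t n ω = i ∧ PrefError I best c a t n ω}
      ≤ 129 * ((D : ℝ) ^ 2 * I.distMax best T n i ^ 2 * I.delta ^ 2 / I.gapMin best T n i) := by
  classical
  set S := I.subRounds best T n i with hS
  set ρ := I.distMax best T n i with hρ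
  set y := I.gapMin best T n i with hy
  obtain ⟨t₀, ht₀⟩ := hne
  have hy0 : 0 < y := Bandit.gapMin_pos ⟨t₀, ht₀⟩
  have hδ : 0 < I.delta := Bandit.delta_pos ht₀
  have hyδρ : y ≤ I.delta * ρ :=
    (Bandit.gapMin_le ht₀).trans (Bandit.gap_le_delta_mul_distMax hbest ht₀)
  have hδρ : 0 < I.delta * ρ := hy0.trans_le hyδρ
  have hρ0 : 0 ≤ ρ := Bandit.distMax_nonneg hbest ht₀
  have hD : (1 : ℝ) ≤ (D : ℝ) ^ 2 := by
    have : (1 : ℝ) ≤ D := by exact_mod_cast Bandit.one_le_dim ht₀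
    nlinarith
  -- Round 1 has no data and is bounded by `δρ`. Later, `t - 1 ≥ t/2` turns the constant `8` into
  -- `16`; altogether `1 + 8 · 16 = 129`.
  have hterm : ∀ t ∈ S, I.gap best t n i * P.real {ω | a t n ω = i ∧ PrefError I best c a t n ω}
      ≤ (if t = 1 then I.delta * ρ else 0)
        + I.gap best t n i * Real.exp (-((t : ℝ) * I.gap best t n i ^ 2 / (16 * (I.delta * ρ) ^ 2))) := by
    intro t ht
    obtain ⟨⟨ht1, _⟩, _, hg⟩ := Bandit.mem_subRounds.1 ht
    rcases ht1.eq_or_lt with rfl | ht2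
    · rw [if_pos rfl]
      have h1 := Bandit.gap_le_delta_mul_distMax hbest ht
      have h2 : P.real {ω | a 1 n ω = i ∧ PrefError I best c a 1 n ω} ≤ 1 := measureReal_le_one
      have h3 := mul_le_mul_of_nonneg_left h2 hg.le
      have h4 : 0 ≤ I.gap best 1 n i
        * Real.exp (-(((1 : ℕ) : ℝ) * I.gap best 1 n i ^ 2 / (16 * (I.delta * ρ) ^ 2))) := by
        positivity
      linarith
    · rw [if_neg (by omega), zero_add]
      refine mul_le_mul_of_nonneg_left ?_ hg.le
      have h1 := measure_prefEst_le hE n (I.meanReward (best t n) - I.meanReward i) hρ0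
        (Bandit.abs_sub_le_distMax hbest ht) hg.le ht2
      refine (measureReal_mono fun ω hω => ?_).trans (h1.trans (Real.exp_le_exp.2 ?_))
      · have h2 := hω.2
        rw [PrefError, hω.1] at h2
        exact h2
      · have ht2' : (2 : ℝ) ≤ t := by exact_mod_cast ht2
        rw [neg_le_neg_iff, div_le_div_iff₀ (by positivity) (by positivity)]
        change (t : ℝ) * I.gap best t n i ^ 2 * (8 * (I.delta * ρ) ^ 2)
          ≤ ((t : ℝ) - 1) * I.gap best t n i ^ 2 * (16 * (I.delta * ρ) ^ 2)
        have : 0 ≤ I.gap best t n i ^ 2 * (8 * (I.delta * ρ) ^ 2) := by positivity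
        nlinarith
  have h1 : ∑ t ∈ S, (if t = 1 then I.delta * ρ else 0) ≤ (I.delta * ρ) ^ 2 / y := by
    rw [Finset.sum_ite_eq']
    have : I.delta * ρ ≤ (I.delta * ρ) ^ 2 / y := by
      rw [le_div_iff₀ hy0, sq]
      exact mul_le_mul_of_nonneg_left hyδρ hδρ.le
    split_ifs
    · exact this
    · positivity
  have h2 := sum_mul_exp_le (A := 16 * (I.delta * ρ) ^ 2) (by positivity) hy0 T S
    (Finset.filter_subset _ _) (fun t => I.gap best t n i) (fun t ht => Bandit.gapMin_le ht)
  calc _ ≤ _ := Finset.sum_le_sum hterm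
    _ ≤ (I.delta * ρ) ^ 2 / y + 8 * (16 * (I.delta * ρ) ^ 2 / y) := by
        rw [Finset.sum_add_distrib]; exact add_le_add h1 h2
    _ = 129 * (1 * ρ ^ 2 * I.delta ^ 2 / y) := by ring
    _ ≤ _ := by gcongr

theorem sum_gap_mul_not_prefError_le (hE : IsEnvironment I P r c) (hA : IsPRUCBUP 𝒰 I P α r c a)
    (hbest : ∀ t n, I.IsBestArm t n (best t n)) (hα0 : 0 < α) (hα1 : α ≤ 1) {n : Fin N} {i : Fin K}
    (hne : (I.subRounds best T n i).Nonempty) :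
    ∑ t ∈ I.subRounds best T n i,
        I.gap best t n i * P.real {ω | a t n ω = i ∧ ¬ PrefError I best c a t n ω}
      ≤ 406 * (I.delta ^ 2 * Real.log ((T : ℝ) / α) / I.gapMin best T n i) := by
  classical
  set S := I.subRounds best T n i with hS
  set y := I.gapMin best T n i with hy
  set L := Real.log ((T : ℝ) / α) with hL
  obtain ⟨t₀, ht₀⟩ := hne
  have hy0 : 0 < y := Bandit.gapMin_pos ⟨t₀, ht₀⟩
  have hδ : 0 < I.delta := Bandit.delta_pos ht₀
  have hyδ : y ≤ I.delta := (Bandit.gapMin_le ht₀).trans (Bandit.gap_le_delta _ _ _)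
  obtain ⟨⟨ht₀1, ht₀T⟩, -, -⟩ := Bandit.mem_subRounds.1 ht₀
  have hT1 : (1 : ℝ) ≤ T := by exact_mod_cast ht₀1.trans ht₀T
  have hTα : (T : ℝ) ≤ T / α := le_div_self (by linarith) hα0 hα1
  have hfirst : ∀ P' : Measure Ω, P'.real {ω | a 1 n ω = i ∧ ¬ PrefError I best c a 1 n ω} = 0 := by
    intro P'
    have : {ω | a 1 n ω = i ∧ ¬ PrefError I best c a 1 n ω} = ∅ :=
      Set.eq_empty_of_forall_notMem fun ω hω =>
        hω.2 (prefError_one I hbest c (hA.mem 1 n ω le_rfl))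
    rw [this, measureReal_empty]
  -- For `T = 1` the logarithm may vanish, but so does the sum. For `T ≥ 2` it is at least `1/2`, so
  -- that log-free terms can be absorbed.
  rcases Nat.lt_or_ge T 2 with hT | hT
  · have hL0 : 0 ≤ L := Real.log_nonneg (by linarith)
    rw [Finset.sum_eq_zero]
    · positivity
    · intro t ht
      obtain ⟨⟨ht1, htT⟩, -, -⟩ := Bandit.mem_subRounds.1 ht
      obtain rfl : t = 1 := by omega
      rw [hfirst, mul_zero]
  have hT2 : (2 : ℝ) ≤ T := by exact_mod_cast hT
  have hL2 : 1 / 2 ≤ L := by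
    have h1 : Real.log 2 ≤ L := Real.log_le_log (by norm_num) (by linarith)
    linarith [Real.log_two_gt_d9]
  set Q : ℕ → Set Ω := fun t => {ω | a t n ω = i ∧
    (pullCount a t i ω : ℝ) * I.gap best t n i ^ 2 ≤ 128 * L * I.delta ^ 2} with hQ
  have hQm : ∀ t ∈ S, MeasurableSet (Q t) := by
    intro t ht
    have h1 := hA.measurable_arm hE (Bandit.mem_subRounds.1 ht).1.1 n (measurableSet_singleton i)
    have h2 : Measurable fun ω => (pullCount a t i ω : ℝ) * I.gap best t n i ^ 2 :=
      (measurable_from_top.comp (hA.measurable_pullCount hE t i)).mul_const _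
    exact h1.inter (measurableSet_le h2 measurable_const)
  -- Three charges: round 2, where `log (t/α)` may be below 1; pulls with few samples; failures of
  -- concentration from round 3 on.
  have hterm : ∀ t ∈ S, I.gap best t n i * P.real {ω | a t n ω = i ∧ ¬ PrefError I best c a t n ω}
      ≤ (if t = 2 then I.delta else 0) + I.gap best t n i * P.real (Q t)
        + (if t ∈ Finset.Icc 3 T then 72 * (I.delta ^ 2 / y) * (1 / (t : ℝ) ^ 2) else 0) := by
    intro t ht
    obtain ⟨⟨ht1, htT⟩, -, hg⟩ := Bandit.mem_subRounds.1 ht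
    have hQ0 : 0 ≤ I.gap best t n i * P.real (Q t) := mul_nonneg hg.le measureReal_nonneg
    rcases (by omega : t = 1 ∨ t = 2 ∨ 3 ≤ t) with rfl | rfl | ht3
    · rw [hfirst, mul_zero]
      simp only [OfNat.one_ne_ofNat, if_false, zero_add]
      simpa using hQ0
    · have h1 : I.gap best 2 n i ≤ I.delta := Bandit.gap_le_delta _ _ _
      have h2 : P.real {ω | a 2 n ω = i ∧ ¬ PrefError I best c a 2 n ω} ≤ 1 := measureReal_le_one
      have h3 := mul_le_mul_of_nonneg_left h2 hg.le
      rw [if_pos rfl, if_neg (by simp)]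
      linarith
    · rw [if_neg (by omega), if_pos (Finset.mem_Icc.2 ⟨ht3, htT⟩), zero_add]
      have h1 := measure_pull_le hE hA hbest hα0 hα1 ht3 hg
      have hlog : Real.log ((t : ℝ) / α) ≤ L := by
        have : (t : ℝ) ≤ T := by exact_mod_cast htT
        have : (0 : ℝ) < t := by positivity
        apply Real.log_le_log (by positivity)
        gcongr
      have hsub : {ω | a t n ω = i ∧ ¬ PrefError I best c a t n ω} ⊆ Q t ∪
          {ω | a t n ω = i ∧ ¬ PrefError I best c a t n ω
            ∧ 128 * Real.log ((t : ℝ) / α) * I.delta ^ 2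
              < (pullCount a t i ω : ℝ) * I.gap best t n i ^ 2} := by
        intro ω hω
        rcases le_or_gt ((pullCount a t i ω : ℝ) * I.gap best t n i ^ 2)
          (128 * Real.log ((t : ℝ) / α) * I.delta ^ 2) with h | h
        · exact Or.inl ⟨hω.1, h.trans (by gcongr)⟩
        · exact Or.inr ⟨hω.1, hω.2, h⟩
      have h2 := (measureReal_mono hsub (measure_ne_top P _)).trans (measureReal_union_le _ _)
      have h3 := mul_le_mul_of_nonneg_left (h2.trans (add_le_add le_rfl h1)) hg.le
      refine h3.trans ?_
      rw [mul_add]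
      refine add_le_add le_rfl ?_
      have h4 : I.delta ^ 2 / I.gap best t n i ≤ I.delta ^ 2 / y := by
        have := Bandit.gapMin_le ht
        gcongr
      calc _ = 72 * (I.delta ^ 2 / I.gap best t n i) * (1 / (t : ℝ) ^ 2) := by
            field_simp
        _ ≤ _ := by gcongr
  have h1 : ∑ t ∈ S, (if t = 2 then I.delta else 0) ≤ I.delta ^ 2 / y := by
    rw [Finset.sum_ite_eq']
    have : I.delta ≤ I.delta ^ 2 / y := by
      rw [le_div_iff₀ hy0, sq]
      exact mul_le_mul_of_nonneg_left hyδ hδ.le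
    split_ifs
    · exact this
    · positivity
  have h2 : ∑ t ∈ S, I.gap best t n i * P.real (Q t)
      ≤ 2 * ((128 * L * I.delta ^ 2 + I.delta ^ 2) / y) := by
    have hint : ∀ t ∈ S, Integrable ((Q t).indicator fun _ => I.gap best t n i) P :=
      fun t ht => integrable_indicator_gap (hQm t ht) _
    calc _ = ∫ ω, ∑ t ∈ S, (Q t).indicator (fun _ => I.gap best t n i) ω ∂P := by
          rw [integral_finsetSum _ hint]
          refine Finset.sum_congr rfl fun t ht => ?_
          rw [integral_indicator_const _ (hQm t ht), smul_eq_mul, mul_comm]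
      _ ≤ ∫ _, 2 * ((128 * L * I.delta ^ 2 + I.delta ^ 2) / y) ∂P :=
          integral_mono (integrable_finsetSum _ hint) (integrable_const _)
            fun ω => sum_indicator_gap_le a ⟨t₀, ht₀⟩ (by positivity) ω
      _ = _ := by simp
  have h3 : ∑ t ∈ S, (if t ∈ Finset.Icc 3 T then 72 * (I.delta ^ 2 / y) * (1 / (t : ℝ) ^ 2) else 0)
      ≤ 72 * (I.delta ^ 2 / y) := by
    rw [← Finset.sum_filter]
    calc _ ≤ ∑ t ∈ Finset.Icc 3 T, 72 * (I.delta ^ 2 / y) * (1 / (t : ℝ) ^ 2) :=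
          Finset.sum_le_sum_of_subset_of_nonneg (fun t ht => (Finset.mem_filter.1 ht).2)
            fun _ _ _ => by positivity
      _ ≤ 72 * (I.delta ^ 2 / y) * 1 := by
          rw [← Finset.mul_sum]
          have := sum_inv_sq_le_one T
          gcongr
      _ = _ := mul_one _
  have h4 : I.delta ^ 2 / y ≤ 2 * (I.delta ^ 2 * L / y) := by
    rw [mul_div_assoc', div_le_div_iff_of_pos_right hy0]
    nlinarith [sq_nonneg I.delta]
  calc _ ≤ _ := Finset.sum_le_sum hterm
    _ ≤ I.delta ^ 2 / y + 2 * ((128 * L * I.delta ^ 2 + I.delta ^ 2) / y)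
        + 72 * (I.delta ^ 2 / y) := by
        rw [Finset.sum_add_distrib, Finset.sum_add_distrib]
        exact add_le_add (add_le_add h1 h2) h3
    -- Here `75 = 1 + 2 + 72`, and absorbing the log-free part gives `256 + 150 = 406`.
    _ = 256 * (I.delta ^ 2 * L / y) + 75 * (I.delta ^ 2 / y) := by ring
    _ ≤ _ := by linarith

end Run

section Bounds

variable (I : Bandit N K D) (best : ℕ → Fin N → Fin K) (T : ℕ)

theorem Bandit.rewardBound_nonneg (α : ℝ) {L : ℝ} (hL : 0 ≤ L) : 0 ≤ I.rewardBound best T α L := by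
  refine Finset.sum_nonneg fun n _ => Finset.sum_nonneg fun i hi => ?_
  have h := (Finset.mem_filter.1 hi).2
  have := Bandit.gapMin_pos h
  have := Bandit.gapMax_pos h
  positivity

theorem Bandit.prefBound_nonneg : 0 ≤ I.prefBound best T := by
  refine Finset.sum_nonneg fun n _ => Finset.sum_nonneg fun i hi => ?_
  have := Bandit.gapMin_pos (Finset.mem_filter.1 hi).2
  positivity

theorem Bandit.rewardBound_le_two_mul (α : ℝ) {L L' : ℝ} (h : L ≤ 2 * L') :
    I.rewardBound best T α L ≤ 2 * I.rewardBound best T α L' := by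
  simp only [Bandit.rewardBound, Finset.mul_sum]
  refine Finset.sum_le_sum fun n _ => Finset.sum_le_sum fun i hi => ?_
  have hne := (Finset.mem_filter.1 hi).2
  have h1 := Bandit.gapMin_pos hne
  have h2 := Bandit.gapMax_pos hne
  have h3 : I.delta ^ 2 * L / I.gapMin best T n i
      ≤ I.delta ^ 2 * (2 * L') / I.gapMin best T n i := by gcongr
  have h4 : 0 ≤ (D : ℝ) * Real.pi ^ 2 * α ^ 2 * I.gapMax best T n i := by positivity
  have h5 : I.delta ^ 2 * (2 * L') / I.gapMin best T n i
      = 2 * (I.delta ^ 2 * L' / I.gapMin best T n i) := by ring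
  linarith

end Bounds

end PAMO

/-! ### Assembly of the regret bound. -/

theorem theorem2 :
    ∃ C : ℝ, 0 < C ∧
      ∀ (N K D : ℕ) (I : PAMO.Bandit N K D) (best : ℕ → Fin N → Fin K)
        (_ : ∀ t n, I.IsBestArm t n (best t n))
        (Ω : Type*) (𝒰 : MeasurableSpace Ω) [mΩ : MeasurableSpace Ω] (P : Measure Ω) [IsProbabilityMeasure P]
        (r : ℕ → Fin N → Fin K → Ω → (Fin D → ℝ)) (c : ℕ → Fin N → Ω → (Fin D → ℝ))
        (_ : PAMO.IsEnvironment I P r c)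
        (α : ℝ) (_ : 0 < α) (_ : α ≤ 1)
        (a : ℕ → Fin N → Ω → Fin K)
        (_ : PAMO.IsPRUCBUP 𝒰 I P α r c a)
        (T : ℕ) (_ : 1 ≤ T),
        -- the regret bound, with the dependence on the parameter of the algorithm explicit
        ∫ ω, PAMO.regret I best a T ω ∂P
            ≤ C * (I.rewardBound best T α (Real.log ((T : ℝ) / α)) + I.prefBound best T) ∧
        -- the regret bound with `log T`, as soon as `T ≥ 1 / α`
        (1 / α ≤ (T : ℝ) →
          ∫ ω, PAMO.regret I best a T ω ∂P
            ≤ C * (I.rewardBound best T α (Real.log (T : ℝ)) + I.prefBound best T)) ∧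
        -- the contributions of the two kinds of estimation errors
        (∀ ω, PAMO.regret I best a T ω
            = PAMO.regretReward I best c a T ω + PAMO.regretPref I best c a T ω) ∧
        ∫ ω, PAMO.regretReward I best c a T ω ∂P
            ≤ C * I.rewardBound best T α (Real.log ((T : ℝ) / α)) ∧
        ∫ ω, PAMO.regretPref I best c a T ω ∂P ≤ C * I.prefBound best T := by
  classical
  -- Twice `406`: the factor 2 pays for replacing `log (T/α)` by `log T`.
  refine ⟨812, by norm_num, ?_⟩
  intro N K D I best hbest Ω 𝒰 mΩ P _ r c hE α hα0 hα1 a hA T hT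
  have hT1 : (1 : ℝ) ≤ T := by exact_mod_cast hT
  have hL : 0 ≤ Real.log ((T : ℝ) / α) :=
    Real.log_nonneg (hT1.trans (le_div_self (by linarith) hα0 hα1))
  have hPB := I.prefBound_nonneg best T
  have hRB := I.rewardBound_nonneg best T α hL
  have hpe : ∀ t n, 1 ≤ t → MeasurableSet {ω | PAMO.PrefError I best c a t n ω} :=
    fun t n ht => hA.measurableSet_prefError hE ht n
  have hpref := PAMO.integrable_sum_ite_gap (T := T) hE hA hbest
    (fun t n ω => PAMO.PrefError I best c a t n ω) hpe
  have hrew := PAMO.integrable_sum_ite_gap (T := T) hE hA hbest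
    (fun t n ω => ¬ PAMO.PrefError I best c a t n ω) fun t n ht => (hpe t n ht).compl
  have epref : PAMO.regretPref I best c a T = fun ω => ∑ t ∈ Finset.Icc 1 T, ∑ n : Fin N,
      (if PAMO.PrefError I best c a t n ω then I.gap best t n (a t n ω) else 0) := rfl
  have erew : PAMO.regretReward I best c a T = fun ω => ∑ t ∈ Finset.Icc 1 T, ∑ n : Fin N,
      (if ¬ PAMO.PrefError I best c a t n ω then I.gap best t n (a t n ω) else 0) := by
    funext ω
    simp only [PAMO.regretReward, ite_not]
  rw [← epref] at hpref
  rw [← erew] at hrew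
  have hsplit : ∀ ω, PAMO.regret I best a T ω
      = PAMO.regretReward I best c a T ω + PAMO.regretPref I best c a T ω := by
    intro ω
    simp only [PAMO.regret, PAMO.regretReward, PAMO.regretPref, ← Finset.sum_add_distrib]
    refine Finset.sum_congr rfl fun t _ => Finset.sum_congr rfl fun n _ => ?_
    split_ifs <;> simp
  have hR : ∫ ω, PAMO.regretReward I best c a T ω ∂P
      ≤ 406 * I.rewardBound best T α (Real.log ((T : ℝ) / α)) := by
    rw [hrew.2]
    simp only [PAMO.Bandit.rewardBound, Finset.mul_sum]
    refine Finset.sum_le_sum fun n _ => Finset.sum_le_sum fun i hi => ?_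
    have hne := (Finset.mem_filter.1 hi).2
    have hmax := PAMO.Bandit.gapMax_pos hne
    refine (PAMO.sum_gap_mul_not_prefError_le hE hA hbest hα0 hα1 hne).trans ?_
    -- The logarithmic term alone suffices; the `α²` term is added only by nonnegativity.
    exact mul_le_mul_of_nonneg_left (le_add_of_nonneg_right (by positivity)) (by norm_num)
  have hP : ∫ ω, PAMO.regretPref I best c a T ω ∂P ≤ 129 * I.prefBound best T := by
    rw [hpref.2]
    simp only [PAMO.Bandit.prefBound, Finset.mul_sum]
    exact Finset.sum_le_sum fun n _ => Finset.sum_le_sum fun i hi =>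
      PAMO.sum_gap_mul_prefError_le hE hbest (Finset.mem_filter.1 hi).2
  have hreg : ∫ ω, PAMO.regret I best a T ω ∂P
      = ∫ ω, PAMO.regretReward I best c a T ω ∂P + ∫ ω, PAMO.regretPref I best c a T ω ∂P := by
    rw [← integral_add]
    · exact integral_congr_ae (Filter.Eventually.of_forall hsplit)
    · exact hrew.1
    · exact hpref.1
  refine ⟨by linarith, fun hTα => ?_, hsplit, by linarith, by linarith⟩
  have hlog : Real.log ((T : ℝ) / α) ≤ 2 * Real.log (T : ℝ) := by
    rw [div_eq_mul_one_div, Real.log_mul (by linarith) (by positivity), two_mul]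
    exact add_le_add le_rfl (Real.log_le_log (by positivity) hTα)
  have := I.rewardBound_le_two_mul best T α hlog
  linarith
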